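/- Let $p>1$, let $q$ be the conjugate exponent ($1/p+1/q=1$), let $\gamma\in(1-1/q,1)$, and let $M,G$ be real numbers with $$M>\frac{\gamma^q}{1-(1-\gamma)q},\qquad G>\frac{\gamma^q}{q(1-(1-\gamma)q)}.$$ Define $a$ on $[0,1]\times\mathbb R$ by $a(t,x)=G^{-1}$ if $x=t^\gamma$ and $a(t,x)=MG^{-1}$ if $x\neq t^\gamma$, and define $g$ on $\mathbb R$ by $g(1)=0$ and $g(x)=1$ for $x\ne 1$. Let $a_n:[0,1]\times\mathbb R\to\mathbb R$ and $g_n:\mathbb R\to\mathbb R$ ($n\ge 1$) be Lipschitz continuous functions such that $G^{-1}\le a_n\le a$ and $0\le g_n\le g$ for all $n\geq 1$, and such that, as $n\to\infty$, $a_n\uparrow a$ pointwise on $[0,1]\times\mathbb R$ and $g_n\uparrow g$ pointwise on $\mathbb R$ (nondecreasing convergence). For each $n\ge1$ let $u_n:[0,1]\times\mathbb R\to\mathbb R$ be the Lipschitz continuous viscosity solution of $$-\partial_t u+\frac{|Du|^p}{p\,a_n^{p-1}(t,x)}=0\ \text{ in }(0,1)\times\mathbb R,\qquad u(1,x)=g_n(x)\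 \text{ for } x\in\mathbb R.$$ Then $\sup_n\|u_n\|_\infty\le 1$, but for every $$\varepsilon\ \ge\ \varepsilon_*(q,\gamma):=\frac{\gamma(q+1)+1-q}{q(1-\gamma)}$$ the sequence $(\partial_t u_n)$ is not bounded in $L^{1+\varepsilon}((0,1)\times(0,1))$ and the sequence $(Du_n)$ is not bounded in $L^{p(1+\varepsilon)}((0,1)\times(0,1))$. Moreover $\varepsilon_*(q,\gamma)>0$, and $\varepsilon_*$ takes arbitrarily small values: for every $\eta>0$ there are $p'>1$, with conjugate exponent $q'$, and $\gamma'\in(1-1/q',1)$ such that $\varepsilon_*(q',\gamma')<\eta$. -/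

import Mathlib

open Set Filter Topology MeasureTheory
open scoped NNReal ENNReal

noncomputable section

namespace HJExample

/-! Points of space-time are pairs `z = (t, x)`, with `z.1` the time and `z.2` the position. -/

/-- The time derivative `∂_t u` of a function of `(t, x)`. -/
def dt (u : ℝ × ℝ → ℝ) (z : ℝ × ℝ) : ℝ := deriv (fun s => u (s, z.2)) z.1

/-- The space derivative `Du` of a function of `(t, x)`. -/
def dx (u : ℝ × ℝ → ℝ) (z : ℝ × ℝ) : ℝ := deriv (fun y => u (z.1, y)) z.2

/-- The closed strip `[0,1] × ℝ`. -/
def closedStrip : Set (ℝ × ℝ) := Icc 0 1 ×ˢ univ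

/-- The open strip `(0,1) × ℝ`. -/
def openStrip : Set (ℝ × ℝ) := Ioo 0 1 ×ˢ univ

/-- Viscosity subsolution of `F(z, ∂_t u, Du) = 0` in the open set `Ω`. -/
def IsViscositySubsolution (F : ℝ × ℝ → ℝ → ℝ → ℝ) (Ω : Set (ℝ × ℝ)) (u : ℝ × ℝ → ℝ) : Prop :=
  ∀ φ : ℝ × ℝ → ℝ, ContDiff ℝ 1 φ → ∀ z ∈ Ω,
    IsLocalMax (fun w => u w - φ w) z → F z (dt φ z) (dx φ z) ≤ 0

/-- Viscosity supersolution of `F(z, ∂_t u, Du) = 0` in the open set `Ω`. -/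
def IsViscositySupersolution (F : ℝ × ℝ → ℝ → ℝ → ℝ) (Ω : Set (ℝ × ℝ)) (u : ℝ × ℝ → ℝ) : Prop :=
  ∀ φ : ℝ × ℝ → ℝ, ContDiff ℝ 1 φ → ∀ z ∈ Ω,
    IsLocalMin (fun w => u w - φ w) z → 0 ≤ F z (dt φ z) (dx φ z)

/-- The operator `-∂_t u + |Du|^p / (p a(t,x)^(p-1))`, as a function of the point and of the
values `τ` of `∂_t u` and `ξ` of `Du`. -/
def hjOperator (p : ℝ) (a : ℝ × ℝ → ℝ) (z : ℝ × ℝ) (τ ξ : ℝ) : ℝ :=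
  -τ + |ξ| ^ p / (p * a z ^ (p - 1))

/-- `u`, Lipschitz continuous on `[0,1] × ℝ`, is a viscosity solution of
`-∂_t u + |Du|^p / (p a^(p-1)) = 0` in `(0,1) × ℝ` with `u(1, ·) = g`. -/
structure IsLipschitzViscositySolution (p : ℝ) (a : ℝ × ℝ → ℝ) (g : ℝ → ℝ)
    (u : ℝ × ℝ → ℝ) : Prop where
  lipschitz : ∃ K : ℝ≥0, LipschitzOnWith K u closedStrip
  subsolution : IsViscositySubsolution (hjOperator p a) openStrip u
  supersolution : IsViscositySupersolution (hjOperator p a) openStrip u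
  terminal : ∀ x : ℝ, u (1, x) = g x

/-- The discontinuous coefficient: `G⁻¹` on the curve `x = t^γ`, and `M G⁻¹` off it. -/
def costCoeff (γ M G : ℝ) (z : ℝ × ℝ) : ℝ :=
  if z.2 = z.1 ^ γ then G⁻¹ else M * G⁻¹

/-- The discontinuous terminal datum: `0` at `x = 1`, and `1` elsewhere. -/
def terminalDatum (x : ℝ) : ℝ := if x = 1 then 0 else 1

/-- `(a_n)_{n ≥ 1}` are Lipschitz continuous on `[0,1] × ℝ`, with `G⁻¹ ≤ a_n ≤ a` and
`a_n ↑ a` pointwise, where `a = costCoeff γ M G`. -/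
structure IsCostApproximation (γ M G : ℝ) (a : ℕ → ℝ × ℝ → ℝ) : Prop where
  lipschitz : ∀ n, 1 ≤ n → ∃ K : ℝ≥0, LipschitzOnWith K (a n) closedStrip
  lower : ∀ n, 1 ≤ n → ∀ z ∈ closedStrip, G⁻¹ ≤ a n z
  upper : ∀ n, 1 ≤ n → ∀ z ∈ closedStrip, a n z ≤ costCoeff γ M G z
  mono : ∀ n, 1 ≤ n → ∀ z ∈ closedStrip, a n z ≤ a (n + 1) z
  tendsto : ∀ z ∈ closedStrip, Tendsto (fun n => a n z) atTop (𝓝 (costCoeff γ M G z))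

/-- `(g_n)_{n ≥ 1}` are Lipschitz continuous on `ℝ`, with `0 ≤ g_n ≤ g` and `g_n ↑ g` pointwise,
where `g = terminalDatum`. -/
structure IsTerminalApproximation (g : ℕ → ℝ → ℝ) : Prop where
  lipschitz : ∀ n, 1 ≤ n → ∃ K : ℝ≥0, LipschitzWith K (g n)
  lower : ∀ n, 1 ≤ n → ∀ x, 0 ≤ g n x
  upper : ∀ n, 1 ≤ n → ∀ x, g n x ≤ terminalDatum x
  mono : ∀ n, 1 ≤ n → ∀ x, g n x ≤ g (n + 1) x
  tendsto : ∀ x, Tendsto (fun n => g n x) atTop (𝓝 (terminalDatum x))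

/-- The sequence `(f_n)_{n ≥ 1}` is bounded in `L^r((0,1) × (0,1))`. -/
def BoundedInLp (r : ℝ) (f : ℕ → ℝ × ℝ → ℝ) : Prop :=
  ∃ C : ℝ≥0, ∀ n, 1 ≤ n →
    eLpNorm (f n) (ENNReal.ofReal r) (volume.restrict (Ioo (0 : ℝ) 1 ×ˢ Ioo (0 : ℝ) 1)) ≤ C

/-- The critical value of `ε`. -/
def criticalEps (q γ : ℝ) : ℝ := (γ * (q + 1) + 1 - q) / (q * (1 - γ))

end HJExample

end

noncomputable section

namespace HJExample

/-! The equation is that of the control problem of minimising `∫ a_n |X'|^q / q + g_n (X 1)` over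
curves `X`. Put `α = 1 - (1 - γ) q > 0` and `c = G⁻¹ γ^q / (q α)`. Following the cheap curve `x =
t^γ` from time `t` to `1` costs at most `c (1 - t^α)`, so `u_n (t, t^γ) ≤ c (1 - t^α)` for every `n`
(`le_on_curve`).

From `x = 0`, nothing beats the full cost `c` in the limit: reaching the cheap curve costs at least
what was saved by not having followed it from time `0`. This uses both size conditions: `M` large
gives `c q < M G⁻¹`, so leaving the curve does not pay, and `G` large gives `c < 1`, so missing the
target `x = 1` does not pay. Hence `u_n (t, 0) ≥ c - η` on `(t₀, 1]` for large `n`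
(`exists_forall_sub_le_at_zero`), by comparison with a maximum of two explicit subsolutions.

With `η` of order `t₀^α`, the oscillation of `u_n (t, ·)` over `[0, t^γ]` is at least `(c / 2) t^α`.
Hölder's inequality then bounds `∫ |Du_n|^r dx` below by a multiple of `t^((α - γ) r + γ)`. For `r =
p (1 + ε)` the exponent is at most `-1` exactly when `ε ≥ ε_*`, and integrating over `(t₀, 1)` gives
a multiple of `-log t₀`, which is arbitrarily large (`le_lintegral_dx_rpow`). The time derivative
follows from `|Du|^p ≤ p A^(p-1) ∂_t u` almost everywhere (`abs_dx_rpow_le`). -/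

/-! ### Localisation of test functions. -/

theorem exists_contDiff_eventuallyEq {φ : ℝ × ℝ → ℝ} {z : ℝ × ℝ} (hφ : ContDiffAt ℝ 1 φ z) :
    ∃ ψ : ℝ × ℝ → ℝ, ContDiff ℝ 1 ψ ∧ ψ =ᶠ[𝓝 z] φ := by
  obtain ⟨s, hs, hφs⟩ := hφ.contDiffOn (m := 1) le_rfl (by simp)
  obtain ⟨r, hr, hrs⟩ := Metric.mem_nhds_iff.1 hs
  let f : ContDiffBump z := ⟨r / 4, r / 2, by positivity, by linarith⟩
  refine ⟨fun w => f w * φ w, ?_, ?_⟩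
  · rw [contDiff_iff_contDiffAt]
    intro w
    by_cases hw : w ∈ Metric.ball z r
    · exact f.contDiff.contDiffAt.mul
        ((hφs.mono hrs).contDiffAt (Metric.isOpen_ball.mem_nhds hw))
    · have : (fun w => f w * φ w) =ᶠ[𝓝 w] fun _ => 0 := by
        have hw' : w ∈ (Metric.closedBall z (r / 2))ᶜ := by
          simp only [Metric.mem_ball, not_lt] at hw
          simp only [mem_compl_iff, Metric.mem_closedBall, not_le]
          linarith
        filter_upwards [Metric.isClosed_closedBall.isOpen_compl.mem_nhds hw'] with y hy
        have : f y = 0 := by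
          apply f.zero_of_le_dist
          simp only [mem_compl_iff, Metric.mem_closedBall, not_le] at hy
          exact hy.le
        simp [this]
      exact contDiffAt_const.congr_of_eventuallyEq this
  · filter_upwards [f.eventuallyEq_one] with w hw
    simp only [Pi.one_apply] at hw
    simp [hw]

theorem tendsto_prodMk_left (z : ℝ × ℝ) : Tendsto (fun s : ℝ => (s, z.2)) (𝓝 z.1) (𝓝 z) :=
  Continuous.tendsto' (by fun_prop) _ _ rfl

theorem tendsto_prodMk_right (z : ℝ × ℝ) : Tendsto (fun y : ℝ => (z.1, y)) (𝓝 z.2) (𝓝 z) :=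
  Continuous.tendsto' (by fun_prop) _ _ rfl

theorem dt_congr {φ ψ : ℝ × ℝ → ℝ} {z : ℝ × ℝ} (h : φ =ᶠ[𝓝 z] ψ) : dt φ z = dt ψ z :=
  EventuallyEq.deriv_eq ((tendsto_prodMk_left z).eventually h)

theorem dx_congr {φ ψ : ℝ × ℝ → ℝ} {z : ℝ × ℝ} (h : φ =ᶠ[𝓝 z] ψ) : dx φ z = dx ψ z :=
  EventuallyEq.deriv_eq ((tendsto_prodMk_right z).eventually h)

/-- Needed because the test functions used below are smooth only near the contact point: they
involve `1 / (t - t₀)`, `t^γ` and possibly non-smooth powers of `|x|`. -/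
theorem IsViscositySupersolution.of_contDiffAt {F : ℝ × ℝ → ℝ → ℝ → ℝ} {Ω : Set (ℝ × ℝ)}
    {u φ : ℝ × ℝ → ℝ} {z : ℝ × ℝ} (hu : IsViscositySupersolution F Ω u) (hz : z ∈ Ω)
    (hφ : ContDiffAt ℝ 1 φ z) (hmin : IsLocalMin (fun w => u w - φ w) z) :
    0 ≤ F z (dt φ z) (dx φ z) := by
  obtain ⟨ψ, hψ, he⟩ := exists_contDiff_eventuallyEq hφ
  rw [← dt_congr he, ← dx_congr he]
  refine hu ψ hψ z hz ?_
  filter_upwards [hmin, he] with w hw hw'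
  rw [he.self_of_nhds, hw']
  exact hw

theorem IsViscositySubsolution.of_contDiffAt {F : ℝ × ℝ → ℝ → ℝ → ℝ} {Ω : Set (ℝ × ℝ)}
    {u φ : ℝ × ℝ → ℝ} {z : ℝ × ℝ} (hu : IsViscositySubsolution F Ω u) (hz : z ∈ Ω)
    (hφ : ContDiffAt ℝ 1 φ z) (hmax : IsLocalMax (fun w => u w - φ w) z) :
    F z (dt φ z) (dx φ z) ≤ 0 := by
  obtain ⟨ψ, hψ, he⟩ := exists_contDiff_eventuallyEq hφ
  rw [← dt_congr he, ← dx_congr he]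
  refine hu ψ hψ z hz ?_
  filter_upwards [hmax, he] with w hw hw'
  rw [he.self_of_nhds, hw']
  exact hw

theorem _root_.ContDiffAt.hasDerivAt_dt {φ : ℝ × ℝ → ℝ} {z : ℝ × ℝ} (h : ContDiffAt ℝ 1 φ z) :
    HasDerivAt (fun s => φ (s, z.2)) (dt φ z) z.1 := by
  have h1 : DifferentiableAt ℝ φ (z.1, z.2) := h.differentiableAt (by simp)
  exact (h1.comp z.1 (f := fun s : ℝ => (s, z.2)) (by fun_prop)).hasDerivAt

/-! ### Comparison with barriers from below. -/

theorem hasDerivAt_const_div_sub (ν t₀ : ℝ) {t : ℝ} (ht : t - t₀ ≠ 0) :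
    HasDerivAt (fun s => ν / (s - t₀)) (-(ν / (t - t₀) ^ 2)) t := by
  refine ((hasDerivAt_const t ν).div ((hasDerivAt_id t).sub_const t₀) ht).congr_deriv ?_
  simp [neg_div]

/-- Comparison from below: a supersolution dominates any continuous function `W` that is touched
from below by smooth subsolutions wherever it exceeds `u`. -/
theorem IsViscositySupersolution.le_of_touching {p : ℝ} {a u W : ℝ × ℝ → ℝ} {t₀ C R : ℝ}
    (hu : IsViscositySupersolution (hjOperator p a) openStrip u)
    (huc : ContinuousOn u closedStrip) (h0 : 0 ≤ t₀)
    (hW : ContinuousOn W (Ioc t₀ 1 ×ˢ univ))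
    (hWC : ∀ z ∈ Ioc t₀ 1 ×ˢ (univ : Set ℝ), W z ≤ C)
    (hR : ∀ z ∈ Ioc t₀ 1 ×ˢ (univ : Set ℝ), R ≤ |z.2| → W z ≤ u z)
    (hterm : ∀ x, W (1, x) ≤ u (1, x))
    (hsub : ∀ z ∈ Ioo t₀ 1 ×ˢ (univ : Set ℝ), u z < W z → ∃ φ : ℝ × ℝ → ℝ,
      ContDiffAt ℝ 1 φ z ∧ φ z = W z ∧ (∀ᶠ w in 𝓝 z, φ w ≤ W w) ∧
      |dx φ z| ^ p / (p * a z ^ (p - 1)) ≤ dt φ z)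
    {z : ℝ × ℝ} (hz : z ∈ Ioc t₀ 1 ×ˢ (univ : Set ℝ)) : W z ≤ u z := by
  by_contra! hlt
  obtain ⟨⟨hz0, hz1⟩, -⟩ := id hz
  have hzR : |z.2| < R := by
    by_contra! h
    exact absurd (hR z hz h) (not_le.2 hlt)
  have hd : 0 < z.1 - t₀ := by linarith
  -- The term `ν / (t - t₀)` blows up at `t₀`, so no initial condition is needed there, and it makes
  -- the touching subsolution strict. Here `ν` is small enough to keep the perturbed difference
  -- negative at `z`.
  obtain ⟨ν, hν, hνlt⟩ : ∃ ν > 0, ν / (z.1 - t₀) < W z - u z := by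
    refine ⟨(W z - u z) * (z.1 - t₀) / 2, ?_, ?_⟩
    · have : 0 < W z - u z := by linarith
      positivity
    · rw [div_lt_iff₀ hd]
      have : 0 < (W z - u z) * (z.1 - t₀) := mul_pos (by linarith) hd
      linarith
  have hsubset : Ioc t₀ 1 ×ˢ (univ : Set ℝ) ⊆ closedStrip :=
    prod_mono (fun s hs => ⟨h0.trans hs.1.le, hs.2⟩) Subset.rfl
  obtain ⟨B, hB⟩ : ∃ B : ℝ, ∀ w ∈ Icc (0 : ℝ) 1 ×ˢ Icc (-R) R, -B ≤ u w := by
    obtain ⟨B, hB⟩ := (isCompact_Icc.prod isCompact_Icc).exists_bound_of_continuousOn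
      (f := u) (s := Icc (0 : ℝ) 1 ×ˢ Icc (-R) R) (huc.mono (prod_mono Subset.rfl (subset_univ _)))
    exact ⟨B, fun w hw => neg_le_of_abs_le (hB w hw)⟩
  set f : ℝ × ℝ → ℝ := fun w => u w - W w + ν / (w.1 - t₀) with hf
  have hfc : ContinuousOn f (Ioc t₀ 1 ×ˢ univ) := by
    refine ((huc.mono hsubset).sub hW).add (continuousOn_const.div (by fun_prop) ?_)
    rintro w ⟨⟨hw, -⟩, -⟩
    exact (sub_pos.2 hw).ne'
  have hfz : f z < 0 := by simp only [hf]; linarith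
  -- For `t - t₀ < δ` the penalty exceeds `|B| + |C| + 1`, so the perturbed difference is positive
  -- there; the second entry keeps `z` in the compact set.
  set δ : ℝ := min (ν / (|B| + |C| + 1)) (z.1 - t₀) with hδ
  have hδ0 : 0 < δ := lt_min (by positivity) hd
  have hout : ∀ w ∈ Ioc t₀ 1 ×ˢ (univ : Set ℝ),
      w ∉ Icc (t₀ + δ) 1 ×ˢ Icc (-R) R → 0 ≤ f w := by
    rintro w hw hw'
    obtain ⟨⟨hw0, hw1⟩, -⟩ := id hw
    have hpos : 0 < w.1 - t₀ := by linarith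
    by_cases hwR : R ≤ |w.2|
    · have := hR w hw hwR
      have : 0 < ν / (w.1 - t₀) := by positivity
      simp only [hf]; linarith
    · have hwR' : w.2 ∈ Icc (-R) R := abs_le.1 (not_le.1 hwR).le
      have hwδ : w.1 - t₀ < δ := by
        by_contra! h
        exact hw' ⟨⟨by linarith, hw1⟩, hwR'⟩
      have h1 : |B| + |C| + 1 ≤ ν / (w.1 - t₀) := by
        rw [le_div_iff₀ hpos, mul_comm, ← le_div_iff₀ (by positivity)]
        exact hwδ.le.trans (min_le_left _ _)
      have h2 := hB w ⟨⟨h0.trans hw0.le, hw1⟩, hwR'⟩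
      have h3 := hWC w hw
      simp only [hf]
      linarith [le_abs_self B, le_abs_self C]
  have hKsub : Icc (t₀ + δ) 1 ×ˢ Icc (-R) R ⊆ Ioc t₀ 1 ×ˢ (univ : Set ℝ) :=
    prod_mono (fun s hs => ⟨by linarith [hs.1], hs.2⟩) (subset_univ _)
  have hzK : z ∈ Icc (t₀ + δ) 1 ×ˢ Icc (-R) R :=
    ⟨⟨by linarith [min_le_right (ν / (|B| + |C| + 1)) (z.1 - t₀)], hz1⟩, abs_le.1 hzR.le⟩
  obtain ⟨m, hmK, hm⟩ := (isCompact_Icc.prod isCompact_Icc).exists_isMinOn ⟨z, hzK⟩ (hfc.mono hKsub)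
  have hfm : f m < 0 := (hm hzK).trans_lt hfz
  have hmin : ∀ w ∈ Ioc t₀ 1 ×ˢ (univ : Set ℝ), f m ≤ f w := by
    intro w hw
    by_cases hwK : w ∈ Icc (t₀ + δ) 1 ×ˢ Icc (-R) R
    · exact hm hwK
    · exact hfm.le.trans (hout w hw hwK)
  obtain ⟨⟨hm0, hm1⟩, -⟩ := hKsub hmK
  have hmpos : 0 < m.1 - t₀ := by linarith
  have hm1' : m.1 < 1 := by
    refine lt_of_le_of_ne hm1 fun h => ?_
    have h1 := hterm m.2
    rw [← h] at h1
    have : 0 < ν / (m.1 - t₀) := by positivity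
    simp only [hf] at hfm
    linarith
  have hmlt : u m < W m := by
    have : 0 < ν / (m.1 - t₀) := by positivity
    simp only [hf] at hfm
    linarith
  obtain ⟨φ, hφ, hφm, hφle, hφsub⟩ := hsub m ⟨⟨hm0, hm1'⟩, mem_univ _⟩ hmlt
  set ψ : ℝ × ℝ → ℝ := fun w => φ w - ν / (w.1 - t₀) with hψ
  have hψd : ContDiffAt ℝ 1 ψ m :=
    hφ.sub (contDiffAt_const.div (contDiffAt_fst.sub contDiffAt_const) hmpos.ne')
  have hloc : IsLocalMin (fun w => u w - ψ w) m := by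
    have hn : Ioo t₀ 1 ×ˢ (univ : Set ℝ) ∈ 𝓝 m :=
      (isOpen_Ioo.prod isOpen_univ).mem_nhds ⟨⟨hm0, hm1'⟩, mem_univ _⟩
    filter_upwards [hn, hφle] with w hw hwφ
    have := hmin w ⟨⟨hw.1.1, hw.1.2.le⟩, mem_univ _⟩
    simp only [hf] at this
    simp only [hψ, hφm]
    linarith
  have key := hu.of_contDiffAt (z := m) ⟨⟨by linarith, hm1'⟩, mem_univ _⟩ hψd hloc
  have hdx : dx ψ m = dx φ m := by
    simp only [dx, hψ]
    exact deriv_sub_const _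
  have hdt : dt ψ m = dt φ m + ν / (m.1 - t₀) ^ 2 := by
    have h1 := hφ.hasDerivAt_dt
    have h2 := hasDerivAt_const_div_sub ν t₀ hmpos.ne'
    rw [← sub_neg_eq_add]
    exact (h1.sub h2).deriv
  rw [hdx, hdt, hjOperator] at key
  have : 0 < ν / (m.1 - t₀) ^ 2 := by positivity
  linarith

/-! ### Upper bounds along curves. -/

theorem neg_mul_le_young {p q : ℝ} (hpq : p.HolderConjugate q) {A : ℝ} (hA : 0 < A) (ξ v : ℝ) :
    -(ξ * v) ≤ A * |v| ^ q / q + |ξ| ^ p / (p * A ^ (p - 1)) := by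
  have hq : q ≠ 0 := hpq.symm.ne_zero
  have hpq' : p / q = p - 1 := hpq.div_conj_eq_sub_one
  have h := Real.young_inequality (-(ξ * A ^ (-q⁻¹))) (v * A ^ q⁻¹) hpq
  rw [abs_neg, abs_mul, abs_mul, abs_of_pos (Real.rpow_pos_of_pos hA _),
    abs_of_pos (Real.rpow_pos_of_pos hA _), Real.mul_rpow (abs_nonneg _) (by positivity),
    Real.mul_rpow (abs_nonneg _) (by positivity), ← Real.rpow_mul hA.le, ← Real.rpow_mul hA.le,
    inv_mul_cancel₀ hq, Real.rpow_one,
    show -q⁻¹ * p = -(p - 1) by rw [← hpq']; ring, Real.rpow_neg hA.le (p - 1)] at h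
  have e : -(ξ * A ^ (-q⁻¹)) * (v * A ^ q⁻¹) = -(ξ * v) := by
    rw [Real.rpow_neg hA.le]
    have : A ^ q⁻¹ ≠ 0 := (Real.rpow_pos_of_pos hA _).ne'
    field_simp
  rw [e] at h
  refine h.trans (le_of_eq ?_)
  have h1 : A ^ (p - 1) ≠ 0 := (Real.rpow_pos_of_pos hA _).ne'
  have h2 : p ≠ 0 := hpq.ne_zero
  field_simp
  ring

theorem abs_sub_le_of_lipschitzOnWith {f : ℝ × ℝ → ℝ} {K : ℝ≥0}
    (hf : LipschitzOnWith K f closedStrip) {t : ℝ} (ht : t ∈ Icc (0 : ℝ) 1) (x y : ℝ) :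
    |f (t, x) - f (t, y)| ≤ K * |x - y| := by
  have h := hf.dist_le_mul (t, x) ⟨ht, mem_univ _⟩ (t, y) ⟨ht, mem_univ _⟩
  rwa [Prod.dist_eq, dist_self, max_eq_right dist_nonneg, Real.dist_eq, Real.dist_eq] at h

theorem exists_pos_mul_lt_and_mul_lt (b c : ℝ) {x y : ℝ} (hx : 0 < x) (hy : 0 < y) :
    ∃ ε > 0, b * ε < x ∧ c * ε < y := by
  have h : ∀ b : ℝ, Tendsto (fun ε : ℝ => b * ε) (𝓝[>] 0) (𝓝 0) := fun b =>
    tendsto_nhdsWithin_of_tendsto_nhds (Continuous.tendsto' (by fun_prop) _ _ (mul_zero b))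
  obtain ⟨ε, ⟨h1, h2⟩, h3⟩ := ((((h b).eventually_lt_const hx).and
    ((h c).eventually_lt_const hy)).and self_mem_nhdsWithin).exists
  exact ⟨ε, h3, h1, h2⟩

set_option maxHeartbeats 1000000 in
/-- Along a curve `X`, a Lipschitz subsolution decreases at most at the rate given by the
Lagrangian `a |X'|^q / q`. -/
theorem IsViscositySubsolution.le_along_curve {p q : ℝ} (hpq : p.HolderConjugate q)
    {a u : ℝ × ℝ → ℝ} {K L : ℝ≥0}
    (hu : IsViscositySubsolution (hjOperator p a) openStrip u)
    (hK : LipschitzOnWith K u closedStrip) (hL : LipschitzOnWith L a closedStrip)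
    (ha : ∀ z ∈ closedStrip, 0 < a z) {X Φ : ℝ → ℝ}
    (hX : ∀ r > 0, ContDiffAt ℝ 1 X r) (hΦ : ∀ r > 0, ContDiffAt ℝ 1 Φ r)
    (hle : ∀ r ∈ Ioo (0 : ℝ) 1, a (r, X r) * |deriv X r| ^ q / q ≤ -deriv Φ r)
    {r s : ℝ} (hr : 0 < r) (hrs : r < s) (hs : s ≤ 1) :
    u (r, X r) - Φ r ≤ u (s, X s) - Φ s := by
  by_contra! hlt
  set θ : ℝ := (u (r, X r) - Φ r) - (u (s, X s) - Φ s) with hθ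
  have hθ0 : 0 < θ := by linarith
  -- Time stays away from `0`, where the derivative of a curve such as `t^γ` may blow up.
  set t₀ : ℝ := r / 2 with ht₀
  have ht0 : 0 < t₀ := by positivity
  have hrt : r - t₀ = r / 2 := by linarith
  set ν : ℝ := θ / 4 * (r / 2) with hν
  have hν0 : 0 < ν := by positivity
  have hνr : ν / (r - t₀) = θ / 4 := by rw [hrt, hν]; field_simp
  have hXc : ContinuousOn X (Icc t₀ s) := fun t ht =>
    (hX t (ht0.trans_le ht.1)).continuousAt.continuousWithinAt
  have hΦc : ContinuousOn Φ (Icc t₀ s) := fun t ht =>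
    (hΦ t (ht0.trans_le ht.1)).continuousAt.continuousWithinAt
  have hX' : ContinuousOn (deriv X) (Icc t₀ s) := by
    have : ContDiffOn ℝ 1 X (Ioi 0) := fun t ht => (hX t ht).contDiffWithinAt
    exact (this.continuousOn_deriv_of_isOpen isOpen_Ioi le_rfl).mono
      fun t ht => ht0.trans_le ht.1
  obtain ⟨B, hB⟩ := isCompact_Icc.exists_bound_of_continuousOn
    (f := fun t => |deriv X t| ^ q / q) (s := Icc t₀ s)
    ((hX'.abs.rpow_const fun _ _ => Or.inr hpq.symm.nonneg).div_const q)
  have hB0 : 0 ≤ B := (norm_nonneg _).trans (hB r ⟨by linarith, hrs.le⟩)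
  -- The maximum of `h` has `|y| ≤ K ε`. The first condition makes the resulting error in `a`
  -- smaller than `ν`; the second excludes a maximum at the final time `s`.
  obtain ⟨ε, hε, hε1, hε2⟩ := exists_pos_mul_lt_and_mul_lt (L * K * B) (K * K) hν0
    (y := θ / 4) (by positivity)
  set h : ℝ × ℝ → ℝ := fun w => u (w.1, X w.1 + w.2) - Φ w.1 - w.2 ^ 2 / ε - ν / (w.1 - t₀) with hh
  have hmem : ∀ t ∈ Icc t₀ s, t ∈ Icc (0 : ℝ) 1 := fun t ht => ⟨ht0.le.trans ht.1, ht.2.trans hs⟩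
  have hucomp : ContinuousOn (fun w : ℝ × ℝ => u (w.1, X w.1 + w.2) - Φ w.1)
      (Icc t₀ s ×ˢ univ) := by
    have hX1 : ContinuousOn (fun w : ℝ × ℝ => X w.1) (Icc t₀ s ×ˢ univ) :=
      hXc.comp continuousOn_fst fun w hw => hw.1
    have hΦ1 : ContinuousOn (fun w : ℝ × ℝ => Φ w.1) (Icc t₀ s ×ˢ univ) :=
      hΦc.comp continuousOn_fst fun w hw => hw.1
    refine ContinuousOn.sub (hK.continuousOn.comp
      (continuousOn_fst.prodMk (hX1.add continuousOn_snd)) ?_) hΦ1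
    exact fun w hw => ⟨hmem _ hw.1, mem_univ _⟩
  have hhc : ContinuousOn h (Ioc t₀ s ×ˢ univ) := by
    refine ContinuousOn.sub (ContinuousOn.sub (hucomp.mono ?_) (by fun_prop))
      (continuousOn_const.div (by fun_prop) ?_)
    · exact prod_mono Ioc_subset_Icc_self Subset.rfl
    · rintro w ⟨⟨hw, -⟩, -⟩
      exact (sub_pos.2 hw).ne'
  obtain ⟨D, hD⟩ := (isCompact_Icc.prod isCompact_Icc).exists_bound_of_continuousOn
    (s := Icc t₀ s ×ˢ Icc (-(K * ε)) (K * ε)) (hucomp.mono (prod_mono Subset.rfl (subset_univ _)))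
  set δ : ℝ := min (ν / (|D| + |h (r, 0)| + 1)) (r - t₀) with hδ
  have hrt0 : 0 < r - t₀ := by rw [hrt]; positivity
  have hδ0 : 0 < δ := lt_min (by positivity) hrt0
  have hKε : 0 ≤ K * ε := by positivity
  have hr0K : (r, (0 : ℝ)) ∈ Icc (t₀ + δ) s ×ˢ Icc (-(K * ε)) (K * ε) :=
    ⟨⟨by linarith [min_le_right (ν / (|D| + |h (r, 0)| + 1)) (r - t₀)], hrs.le⟩,
      by simpa using hKε, hKε⟩
  have hKsub : Icc (t₀ + δ) s ×ˢ Icc (-(K * ε)) (K * ε) ⊆ Ioc t₀ s ×ˢ (univ : Set ℝ) :=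
    prod_mono (fun t ht => ⟨by linarith [ht.1], ht.2⟩) (subset_univ _)
  obtain ⟨m, hmK, hm⟩ := (isCompact_Icc.prod isCompact_Icc).exists_isMaxOn ⟨_, hr0K⟩
    (hhc.mono hKsub)
  have hm_r : h (r, 0) ≤ h m := hm hr0K
  have hmax' : ∀ w ∈ Ioc t₀ s ×ˢ Icc (-(K * ε)) (K * ε), h w ≤ h m := by
    rintro w ⟨hw1, hw2⟩
    by_cases hwδ : t₀ + δ ≤ w.1
    · exact hm ⟨⟨hwδ, hw1.2⟩, hw2⟩
    · have hpos : 0 < w.1 - t₀ := sub_pos.2 hw1.1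
      have h1 : |D| + |h (r, 0)| + 1 ≤ ν / (w.1 - t₀) := by
        rw [le_div_iff₀ hpos, mul_comm, ← le_div_iff₀ (by positivity)]
        exact (by linarith [not_le.1 hwδ] : w.1 - t₀ ≤ δ).trans (min_le_left _ _)
      have h2 := le_of_abs_le (hD w ⟨⟨hw1.1.le, hw1.2⟩, hw2⟩)
      have h3 : 0 ≤ w.2 ^ 2 / ε := by positivity
      refine le_trans ?_ hm_r
      have h4 : h w = u (w.1, X w.1 + w.2) - Φ w.1 - w.2 ^ 2 / ε - ν / (w.1 - t₀) := rfl
      rw [h4]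
      linarith [le_abs_self D, neg_abs_le (h (r, 0))]
  have hmax : ∀ w ∈ Ioc t₀ s ×ˢ (univ : Set ℝ), h w ≤ h m := by
    rintro ⟨t, y⟩ ⟨hw1, -⟩
    simp only at hw1
    by_cases hy : |y| ≤ K * ε
    · exact hmax' _ ⟨hw1, abs_le.1 hy⟩
    -- Beyond `|y| = K ε` the penalty `y² / ε` outweighs the Lipschitz gain `K |y|`, so the point on
    -- the curve does better.
    · refine le_trans ?_ (hmax' (t, 0) ⟨hw1, by simpa using hKε, hKε⟩)
      have h1 := le_of_abs_le
        (abs_sub_le_of_lipschitzOnWith hK (hmem t ⟨hw1.1.le, hw1.2⟩) (X t + y) (X t + 0))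
      have h2 : K * |y| ≤ y ^ 2 / ε := by
        rw [le_div_iff₀ hε, ← sq_abs, sq]
        nlinarith [abs_nonneg y]
      simp only [hh]
      rw [show X t + y - (X t + 0) = y by ring] at h1
      simp only [ne_eq, OfNat.ofNat_ne_zero, not_false_eq_true, zero_pow, zero_div]
      linarith
  obtain ⟨t, y⟩ := m
  obtain ⟨⟨hm0, hms⟩, -⟩ := hKsub hmK
  have hyK : |y| ≤ K * ε := abs_le.2 hmK.2
  simp only at hm0 hms
  have hlip := fun f (K' : ℝ≥0) (hf : LipschitzOnWith K' f closedStrip) => le_of_abs_le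
    (abs_sub_le_of_lipschitzOnWith hf (hmem t ⟨hm0.le, hms⟩) (X t + y) (X t))
  simp only [add_sub_cancel_left] at hlip
  have htpos : 0 < t - t₀ := sub_pos.2 hm0
  have hts : t < s := by
    refine lt_of_le_of_ne hms fun h0 => ?_
    have h1 := hlip u K hK
    have h2 : (K : ℝ) * |y| ≤ K * K * ε := by rw [mul_assoc]; gcongr
    have h3 : 0 ≤ y ^ 2 / ε := by positivity
    have h4 : 0 < ν / (t - t₀) := by positivity
    simp only [hh, add_zero, hνr, ne_eq, OfNat.ofNat_ne_zero, not_false_eq_true, zero_pow,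
      zero_div] at hm_r
    rw [h0] at h1 hm_r h4
    linarith
  have ht1 : t < 1 := hts.trans_le hs
  have htp : 0 < t := ht0.trans hm0
  set ψ : ℝ × ℝ → ℝ := fun w => Φ w.1 + (w.2 - X w.1) ^ 2 / ε + ν / (w.1 - t₀) with hψ
  set z : ℝ × ℝ := (t, X t + y) with hz
  have hψd : ContDiffAt ℝ 1 ψ z := by
    have hX1 : ContDiffAt ℝ 1 (fun w : ℝ × ℝ => X w.1) z :=
      ContDiffAt.comp z (hX t htp) contDiffAt_fst
    have hΦ1 : ContDiffAt ℝ 1 (fun w : ℝ × ℝ => Φ w.1) z :=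
      ContDiffAt.comp z (hΦ t htp) contDiffAt_fst
    exact (hΦ1.add (((contDiffAt_snd.sub hX1).pow 2).div_const ε)).add
      (contDiffAt_const.div (contDiffAt_fst.sub contDiffAt_const) htpos.ne')
  have hloc : IsLocalMax (fun w => u w - ψ w) z := by
    have hn : Ioo t₀ s ×ˢ (univ : Set ℝ) ∈ 𝓝 z :=
      (isOpen_Ioo.prod isOpen_univ).mem_nhds ⟨⟨hm0, hts⟩, mem_univ _⟩
    filter_upwards [hn] with w hw
    have := hmax (w.1, w.2 - X w.1) ⟨⟨hw.1.1, hw.1.2.le⟩, mem_univ _⟩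
    simp only [hh, add_sub_cancel, Prod.mk.eta] at this
    simp only [hψ, hz, add_sub_cancel_left]
    linarith
  have key := hu.of_contDiffAt (z := z) ⟨⟨htp, ht1⟩, mem_univ _⟩ hψd hloc
  have hdx : dx ψ z = 2 * y / ε := by
    have h1 := (((((hasDerivAt_id z.2).sub_const (X t)).pow 2).div_const ε).const_add
      (Φ t)).add_const (ν / (t - t₀))
    refine h1.deriv.trans ?_
    simp [hz]
  have hdt : dt ψ z = deriv Φ t - 2 * y / ε * deriv X t - ν / (t - t₀) ^ 2 := by
    have hXd : HasDerivAt X (deriv X t) t := ((hX t htp).differentiableAt (by simp)).hasDerivAt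
    have hΦd : HasDerivAt Φ (deriv Φ t) t := ((hΦ t htp).differentiableAt (by simp)).hasDerivAt
    have h1 := (hΦd.add (((hXd.const_sub z.2).pow 2).div_const ε)).add
      (hasDerivAt_const_div_sub ν t₀ htpos.ne')
    refine h1.deriv.trans ?_
    simp [hz]
    ring
  have hzs : z ∈ closedStrip := ⟨⟨htp.le, ht1.le⟩, mem_univ _⟩
  rw [hdx, hdt, hjOperator] at key
  -- Young's inequality eliminates the gradient `2 y / ε`, however large: what remains is `ν / (t -
  -- t₀)²` bounded by the variation of `a` between `z` and the curve, which is less than `ν`.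
  have hy := neg_mul_le_young hpq (ha z hzs) (2 * y / ε) (deriv X t)
  have hl := hle t ⟨htp, ht1⟩
  have hBt := le_of_abs_le (hB t ⟨hm0.le, hms⟩)
  have hBn : 0 ≤ |deriv X t| ^ q / q := by
    have := hpq.symm.nonneg
    positivity
  have h1 : (a z - a (t, X t)) * (|deriv X t| ^ q / q) ≤ L * K * B * ε := by
    calc (a z - a (t, X t)) * (|deriv X t| ^ q / q) ≤ L * |y| * (|deriv X t| ^ q / q) := by
          gcongr
          exact hlip a L hL
      _ ≤ L * (K * ε) * B := by gcongr
      _ = L * K * B * ε := by ring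
  have h2 : ν ≤ ν / (t - t₀) ^ 2 := by
    rw [le_div_iff₀ (by positivity)]
    have : (t - t₀) ^ 2 ≤ 1 := pow_le_one₀ htpos.le (by linarith)
    nlinarith
  have h3 : (a z - a (t, X t)) * (|deriv X t| ^ q / q) =
      a z * |deriv X t| ^ q / q - a (t, X t) * |deriv X t| ^ q / q := by ring
  linarith

/-! ### Self-similar barriers. -/

/-- The self-similar barrier `b - k |x - x₀|^m (t - t₀)^(-e)`. -/
def barrier (k m e b x₀ t₀ : ℝ) (z : ℝ × ℝ) : ℝ := b - k * (|z.2 - x₀| ^ m * (z.1 - t₀) ^ (-e))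

theorem continuousOn_barrier {k m e b x₀ t₀ : ℝ} (hm : 0 ≤ m) :
    ContinuousOn (barrier k m e b x₀ t₀) (Ioi t₀ ×ˢ univ) := by
  refine continuousOn_const.sub (continuousOn_const.mul (ContinuousOn.mul ?_ ?_))
  · exact ContinuousOn.rpow_const (by fun_prop) fun _ _ => Or.inr hm
  · exact ContinuousOn.rpow_const (by fun_prop) fun z hz => Or.inl (sub_pos.2 hz.1).ne'

theorem contDiffAt_abs_rpow {m y : ℝ} (h : 1 < m ∨ y ≠ 0) :
    ContDiffAt ℝ 1 (fun y : ℝ => |y| ^ m) y := by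
  rcases h with h | h
  · simpa using (contDiff_norm_rpow (E := ℝ) h).contDiffAt (x := y)
  · exact (contDiffAt_abs h).rpow_const_of_ne (abs_ne_zero.2 h)

theorem abs_deriv_abs_rpow {m y : ℝ} (hm : 0 ≤ m) (h : 1 < m ∨ y ≠ 0) :
    |deriv (fun y : ℝ => |y| ^ m) y| = m * |y| ^ (m - 1) := by
  rcases eq_or_ne y 0 with rfl | hy
  · have h1 : 1 < m := by simpa using h
    rw [(hasDerivAt_abs_rpow 0 h1).deriv]
    simp [Real.zero_rpow (sub_pos.2 h1).ne']
  · have h1 : HasDerivAt (fun y : ℝ => |y| ^ m) _ y :=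
      (hasDerivAt_abs hy).rpow_const (Or.inl (abs_ne_zero.2 hy))
    rw [h1.deriv, abs_mul, abs_mul, abs_of_nonneg hm,
      abs_of_nonneg (by positivity : 0 ≤ |y| ^ (m - 1))]
    have : |(SignType.sign y : ℝ)| = 1 := by
      rcases hy.lt_or_gt with h | h <;> simp [h]
    rw [this, one_mul]

theorem contDiffAt_barrier {k m e b x₀ t₀ : ℝ} {z : ℝ × ℝ} (ht : t₀ < z.1)
    (h : 1 < m ∨ z.2 - x₀ ≠ 0) : ContDiffAt ℝ 1 (barrier k m e b x₀ t₀) z := by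
  have h1 : ContDiffAt ℝ 1 (fun w : ℝ × ℝ => |w.2 - x₀| ^ m) z :=
    ContDiffAt.comp z (contDiffAt_abs_rpow h) (contDiffAt_snd.sub contDiffAt_const)
  have h2 : ContDiffAt ℝ 1 (fun w : ℝ × ℝ => (w.1 - t₀) ^ (-e)) z :=
    (contDiffAt_fst.sub contDiffAt_const).rpow_const_of_ne (sub_pos.2 ht).ne'
  exact contDiffAt_const.sub (contDiffAt_const.mul (h1.mul h2))

theorem dt_barrier {k m e b x₀ t₀ : ℝ} {z : ℝ × ℝ} (ht : t₀ < z.1) :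
    dt (barrier k m e b x₀ t₀) z = k * e * |z.2 - x₀| ^ m * (z.1 - t₀) ^ (-e - 1) := by
  have h1 := ((((hasDerivAt_id z.1).sub_const t₀).rpow_const (p := -e)
    (Or.inl (sub_pos.2 ht).ne')).const_mul (|z.2 - x₀| ^ m)).const_mul k
  refine (h1.const_sub b).deriv.trans ?_
  simp only [id]
  ring

theorem abs_dx_barrier {k m e b x₀ t₀ : ℝ} {z : ℝ × ℝ} (hk : 0 ≤ k) (hm : 0 ≤ m) (ht : t₀ < z.1)
    (h : 1 < m ∨ z.2 - x₀ ≠ 0) :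
    |dx (barrier k m e b x₀ t₀) z| = k * m * |z.2 - x₀| ^ (m - 1) * (z.1 - t₀) ^ (-e) := by
  have h0 : DifferentiableAt ℝ (fun y : ℝ => |y| ^ m) (z.2 - x₀) :=
    (contDiffAt_abs_rpow h).differentiableAt (by simp)
  have h1 : HasDerivAt (fun y => |y - x₀| ^ m) (deriv (fun y : ℝ => |y| ^ m) (z.2 - x₀)) z.2 := by
    simpa using h0.hasDerivAt.comp_sub_const z.2 x₀
  have h2 : dx (barrier k m e b x₀ t₀) z = _ :=
    (((h1.mul_const ((z.1 - t₀) ^ (-e))).const_mul k).const_sub b).deriv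
  have h3 : 0 < (z.1 - t₀) ^ (-e) := Real.rpow_pos_of_pos (sub_pos.2 ht) _
  rw [h2, abs_neg, abs_mul, abs_mul, abs_of_pos h3, abs_of_nonneg hk, abs_deriv_abs_rpow hm h]
  ring

/-- The fundamental solution `b - k |x - x₀|^q / (t - t₀)^(q-1)` is a subsolution wherever the
coefficient is at least `k q`. -/
theorem barrier_subsolution {p q k b x₀ t₀ A : ℝ} (hpq : p.HolderConjugate q) {z : ℝ × ℝ}
    (hk : 0 ≤ k) (ht : t₀ < z.1) (hA0 : 0 < A) (hA : k * q ≤ A) :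
    |dx (barrier k q (q - 1) b x₀ t₀) z| ^ p / (p * A ^ (p - 1)) ≤
      dt (barrier k q (q - 1) b x₀ t₀) z := by
  have hq := hpq.symm.pos
  have hp := hpq.pos
  have hτ : 0 < z.1 - t₀ := sub_pos.2 ht
  have e1 : (q - 1) * p = q := hpq.symm.sub_one_mul_conj
  rw [abs_dx_barrier hk hq.le ht (Or.inl hpq.symm.lt), dt_barrier ht,
    Real.mul_rpow (by positivity) (by positivity), Real.mul_rpow (by positivity) (by positivity),
    ← Real.rpow_mul (abs_nonneg _), ← Real.rpow_mul hτ.le, neg_mul, e1,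
    show -(q - 1) - 1 = -q by ring, div_le_iff₀ (by positivity)]
  have h1 : (k * q) ^ p ≤ k * q * A ^ (p - 1) := by
    rcases eq_or_lt_of_le (by positivity : 0 ≤ k * q) with h | h
    · rw [← h, Real.zero_rpow hp.ne', zero_mul]
    · calc (k * q) ^ p = (k * q) * (k * q) ^ (p - 1) := by
            rw [← Real.rpow_one_add' h.le (by linarith)]; ring_nf
        _ ≤ _ := by gcongr; linarith [hpq.lt]
  calc (k * q) ^ p * |z.2 - x₀| ^ q * (z.1 - t₀) ^ (-q)
      ≤ k * q * A ^ (p - 1) * |z.2 - x₀| ^ q * (z.1 - t₀) ^ (-q) := by gcongr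
    _ = k * ((q - 1) * p) * A ^ (p - 1) * |z.2 - x₀| ^ q * (z.1 - t₀) ^ (-q) := by rw [e1]
    _ = _ := by ring

/-! ### Bounds for a single Lipschitz solution. -/

theorem closure_Ioc_prod : closure (Ioc (0 : ℝ) 1 ×ˢ (univ : Set ℝ)) = closedStrip := by
  rw [closure_prod_eq, closure_Ioc zero_ne_one, closure_univ]; rfl

theorem exists_growth {A q B K : ℝ} (hA : 0 < A) (hq : 1 < q) :
    ∃ R : ℝ, 1 ≤ R ∧ ∀ y, R ≤ y → B + K * y ≤ A * y ^ q := by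
  have h := ((tendsto_rpow_atTop (sub_pos.2 hq)).const_mul_atTop hA).eventually_ge_atTop (|B| + K)
  obtain ⟨R, hR⟩ := (h.and (eventually_ge_atTop 1)).exists_forall_of_atTop
  refine ⟨max R 1, le_max_right _ _, fun y hy => ?_⟩
  obtain ⟨h1, h2⟩ := hR y ((le_max_left _ _).trans hy)
  have e : y ^ q = y ^ (q - 1) * y := by
    rw [← Real.rpow_add_one (by linarith)]; ring_nf
  rw [e]
  nlinarith [le_abs_self B, abs_nonneg B]

section Bounds

variable {p q A : ℝ} {a u : ℝ × ℝ → ℝ} {g : ℝ → ℝ}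

/-- The fundamental solution centred at `x₀` with top value `0` is a subsolution lying below the
terminal datum. It decays superlinearly in `x`, whereas `u` has at most linear growth, so it is
below `u` for large `|x|` and comparison applies; at `x = x₀` it vanishes. -/
theorem IsLipschitzViscositySolution.nonneg (hpq : p.HolderConjugate q) (hA : 0 < A)
    (ha : ∀ z ∈ closedStrip, A ≤ a z) (hu : IsLipschitzViscositySolution p a g u)
    (hg : ∀ x, 0 ≤ g x) : ∀ z ∈ closedStrip, 0 ≤ u z := by
  obtain ⟨K, hK⟩ := hu.lipschitz
  have hq := hpq.symm.pos
  rw [← closure_Ioc_prod]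
  refine le_on_closure (f := fun _ => (0 : ℝ)) ?_ continuousOn_const
    (closure_Ioc_prod ▸ hK.continuousOn)
  rintro ⟨t, x₀⟩ hz
  obtain ⟨R, hR1, hR⟩ := exists_growth (A := A / q) (B := |u (1, x₀)| + K) (K := K)
    (by positivity) hpq.symm.lt
  have hle : ∀ w : ℝ × ℝ, w ∈ Ioc (0 : ℝ) 1 ×ˢ (univ : Set ℝ) →
      barrier (A / q) q (q - 1) 0 x₀ 0 w ≤ -(A / q * |w.2 - x₀| ^ q) := by
    rintro w ⟨⟨hw0, hw1⟩, -⟩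
    have h1 : 1 ≤ w.1 ^ (-(q - 1)) :=
      Real.one_le_rpow_of_pos_of_le_one_of_nonpos hw0 hw1 (by linarith [hpq.symm.lt])
    have h2 : 0 ≤ A / q * |w.2 - x₀| ^ q := by positivity
    simp only [barrier, sub_zero, zero_sub]
    nlinarith
  have := hu.supersolution.le_of_touching (W := barrier (A / q) q (q - 1) 0 x₀ 0) (t₀ := 0)
    (C := 0) (R := R + |x₀|) hK.continuousOn le_rfl
    ((continuousOn_barrier hq.le).mono (prod_mono Ioc_subset_Ioi_self Subset.rfl)) ?_ ?_ ?_ ?_ hz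
  · simpa [barrier, Real.zero_rpow hq.ne'] using this
  · intro w hw
    refine (hle w hw).trans ?_
    have : 0 ≤ A / q * |w.2 - x₀| ^ q := by positivity
    linarith
  · rintro w hw hwR
    refine (hle w hw).trans ?_
    have h1 := hR |w.2 - x₀| (by linarith [abs_sub_abs_le_abs_sub w.2 x₀])
    have h2 := hK.dist_le_mul w ⟨⟨hw.1.1.le, hw.1.2⟩, mem_univ _⟩ (1, x₀)
      ⟨⟨zero_le_one, le_rfl⟩, mem_univ _⟩
    have h3 : dist w (1, x₀) ≤ 1 + |w.2 - x₀| := by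
      rw [Prod.dist_eq, Real.dist_eq, Real.dist_eq]
      refine max_le ?_ (by linarith)
      rw [abs_sub_comm, abs_of_nonneg (by linarith [hw.1.2])]
      linarith [hw.1.1, abs_nonneg (w.2 - x₀)]
    have h4 : (K : ℝ) * dist w (1, x₀) ≤ K * (1 + |w.2 - x₀|) := by gcongr
    rw [Real.dist_eq] at h2
    have h5 := neg_abs_le (u w - u (1, x₀))
    have h6 := neg_abs_le (u (1, x₀))
    linarith
  · intro x
    rw [hu.terminal]
    refine (hle (1, x) ⟨⟨one_pos, le_rfl⟩, mem_univ _⟩).trans (le_trans ?_ (hg x))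
    have : 0 ≤ A / q * |x - x₀| ^ q := by positivity
    simpa using this
  · rintro w ⟨⟨hw0, hw1⟩, -⟩ -
    have haw := ha w ⟨⟨hw0.le, hw1.le⟩, mem_univ _⟩
    exact ⟨_, contDiffAt_barrier hw0 (Or.inl hpq.symm.lt), rfl, .of_forall fun _ => le_rfl,
      barrier_subsolution hpq (by positivity) hw0 (hA.trans_le haw)
        ((div_mul_cancel₀ A hq.ne').trans_le haw)⟩

/-- Standing still costs nothing. -/
theorem IsLipschitzViscositySolution.le_terminal (hpq : p.HolderConjugate q)
    (haL : ∃ L : ℝ≥0, LipschitzOnWith L a closedStrip)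
    (ha : ∀ z ∈ closedStrip, 0 < a z) (hu : IsLipschitzViscositySolution p a g u) :
    ∀ z ∈ closedStrip, u z ≤ g z.2 := by
  obtain ⟨K, hK⟩ := hu.lipschitz
  obtain ⟨L, hL⟩ := haL
  have hmap : ContinuousOn (fun z : ℝ × ℝ => g z.2) closedStrip := by
    have : (fun z : ℝ × ℝ => g z.2) = fun z => u (1, z.2) := by
      funext z; rw [hu.terminal]
    rw [this]
    exact hK.continuousOn.comp (by fun_prop) fun z _ => ⟨⟨zero_le_one, le_rfl⟩, mem_univ _⟩
  rw [← closure_Ioc_prod] at hmap ⊢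
  refine le_on_closure ?_ (closure_Ioc_prod ▸ hK.continuousOn) hmap
  rintro ⟨t, x⟩ ⟨⟨ht0, ht1⟩, -⟩
  rcases eq_or_lt_of_le ht1 with h | h
  · simp only at h
    rw [h, hu.terminal]
  · have := hu.subsolution.le_along_curve hpq hK hL ha (X := fun _ => x) (Φ := fun _ => 0)
      (fun _ _ => contDiffAt_const) (fun _ _ => contDiffAt_const) ?_ ht0 h le_rfl
    · simpa [hu.terminal] using this
    · intro r _
      simp [Real.zero_rpow hpq.symm.ne_zero]

/-- The value on the cheap curve `x = t^γ` is at most the cost of following it. -/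
theorem IsLipschitzViscositySolution.le_on_curve (hpq : p.HolderConjugate q)
    (haL : ∃ L : ℝ≥0, LipschitzOnWith L a closedStrip)
    (ha : ∀ z ∈ closedStrip, 0 < a z) (hu : IsLipschitzViscositySolution p a g u)
    {γ α : ℝ} (hα : α = 1 - (1 - γ) * q) (hα0 : 0 < α) (hγ : 0 < γ)
    (hcurve : ∀ t ∈ Ioo (0 : ℝ) 1, a (t, t ^ γ) ≤ A) {t : ℝ} (ht : t ∈ Ioo (0 : ℝ) 1) :
    u (t, t ^ γ) ≤ g 1 + A * (γ ^ q / (q * α)) * (1 - t ^ α) := by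
  obtain ⟨K, hK⟩ := hu.lipschitz
  obtain ⟨L, hL⟩ := haL
  have hq := hpq.symm.pos
  have := hu.subsolution.le_along_curve hpq hK hL ha (X := fun r => r ^ γ)
    (Φ := fun r => A * (γ ^ q / (q * α)) * (1 - r ^ α))
    (fun r hr => contDiffAt_id.rpow_const_of_ne hr.ne')
    (fun r hr => contDiffAt_const.mul
      (contDiffAt_const.sub (contDiffAt_id.rpow_const_of_ne hr.ne'))) ?_ ht.1 ht.2 le_rfl
  · simp only [Real.one_rpow, sub_self, mul_zero, sub_zero, hu.terminal] at this
    linarith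
  · intro r hr
    have h1 : deriv (fun r : ℝ => r ^ γ) r = γ * r ^ (γ - 1) :=
      (Real.hasDerivAt_rpow_const (Or.inl hr.1.ne')).deriv
    have h2 : deriv (fun r : ℝ => A * (γ ^ q / (q * α)) * (1 - r ^ α)) r =
        A * (γ ^ q / (q * α)) * -(α * r ^ (α - 1)) :=
      (((Real.hasDerivAt_rpow_const (Or.inl hr.1.ne')).const_sub 1).const_mul _).deriv
    have hr0 : 0 < r := hr.1
    rw [h1, h2, abs_of_pos (by positivity), Real.mul_rpow hγ.le (by positivity),
      ← Real.rpow_mul hr0.le, show (γ - 1) * q = α - 1 by rw [hα]; ring]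
    have h3 : -(A * (γ ^ q / (q * α)) * -(α * r ^ (α - 1))) = A * (γ ^ q * r ^ (α - 1)) / q := by
      field_simp
    rw [h3]
    have := hcurve r hr
    gcongr

/-- Mere differentiability of `u` does not provide a `C¹` test function, so the inequality is
obtained by differentiating the curve estimate along the line of slope `v`. -/
theorem IsLipschitzViscositySolution.neg_mul_dx_sub_le (hpq : p.HolderConjugate q)
    (haL : ∃ L : ℝ≥0, LipschitzOnWith L a closedStrip)
    (ha : ∀ z ∈ closedStrip, 0 < a z) (hu : IsLipschitzViscositySolution p a g u)
    (haA : ∀ z ∈ openStrip, a z ≤ A) {z : ℝ × ℝ} (hz : z ∈ openStrip)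
    (hd : DifferentiableAt ℝ u z) (v : ℝ) : -(v * dx u z) - A * |v| ^ q / q ≤ dt u z := by
  obtain ⟨K, hK⟩ := hu.lipschitz
  obtain ⟨L, hL⟩ := haL
  obtain ⟨t, x⟩ := z
  obtain ⟨⟨ht0, ht1⟩, -⟩ := hz
  simp only at ht0 ht1
  have hq := hpq.symm.pos
  set X : ℝ → ℝ := fun r => x + v * (r - t) with hX
  have hXd : ∀ r, HasDerivAt X v r := fun r => by
    have h := (((hasDerivAt_id r).sub_const t).const_mul v).const_add x
    rw [mul_one] at h
    exact h
  have hmono : ∀ s, t < s → s < 1 →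
      u (t, X t) - -(A * |v| ^ q / q) * t ≤ u (s, X s) - -(A * |v| ^ q / q) * s := by
    intro s hs hs1
    refine hu.subsolution.le_along_curve hpq hK hL ha (X := X)
      (Φ := fun r => -(A * |v| ^ q / q) * r) (fun r _ => ?_) (fun r _ => ?_) ?_ ht0 hs hs1.le
    · simp only [hX]; fun_prop
    · fun_prop
    · intro r hr
      have h2 : deriv (fun r : ℝ => -(A * |v| ^ q / q) * r) r = -(A * |v| ^ q / q) := by
        simp
      rw [(hXd r).deriv, h2, neg_neg]
      have := haA (r, X r) ⟨hr, mem_univ _⟩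
      gcongr
  have hXt : X t = x := by simp [hX]
  have hdF : HasFDerivAt u (fderiv ℝ u (t, x)) (t, X t) := by rw [hXt]; exact hd.hasFDerivAt
  have hder : HasDerivAt (fun s => u (s, X s)) (fderiv ℝ u (t, x) (1, v)) t :=
    hdF.comp_hasDerivAt t ((hasDerivAt_id t).prodMk (hXd t))
  have hdt : dt u (t, x) = fderiv ℝ u (t, x) (1, 0) :=
    (hd.hasFDerivAt.comp_hasDerivAt t ((hasDerivAt_id t).prodMk (hasDerivAt_const t x))).deriv
  have hdx : dx u (t, x) = fderiv ℝ u (t, x) (0, 1) :=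
    (hd.hasFDerivAt.comp_hasDerivAt x ((hasDerivAt_const x t).prodMk (hasDerivAt_id x))).deriv
  have hsplit : fderiv ℝ u (t, x) (1, v) = dt u (t, x) + v * dx u (t, x) := by
    rw [hdt, hdx, ← smul_eq_mul, ← map_smul, ← map_add]
    simp
  have hlim := (hasDerivAt_iff_tendsto_slope.1 hder).mono_left
    (nhdsWithin_mono t (fun s (hs : s ∈ Ioi t) => (ne_of_gt hs : s ≠ t)))
  have : -(A * |v| ^ q / q) ≤ fderiv ℝ u (t, x) (1, v) := by
    refine ge_of_tendsto hlim ?_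
    filter_upwards [Ioo_mem_nhdsGT ht1] with s hs
    rw [slope_def_field, le_div_iff₀ (sub_pos.2 hs.1)]
    linarith [hmono s hs.1 hs.2]
  rw [hsplit] at this
  linarith

/-- At a point of differentiability, a Lipschitz solution satisfies the subsolution inequality. -/
theorem IsLipschitzViscositySolution.abs_dx_rpow_le (hpq : p.HolderConjugate q)
    (haL : ∃ L : ℝ≥0, LipschitzOnWith L a closedStrip)
    (ha : ∀ z ∈ closedStrip, 0 < a z) (hu : IsLipschitzViscositySolution p a g u) (hA : 0 < A)
    (haA : ∀ z ∈ openStrip, a z ≤ A) {z : ℝ × ℝ} (hz : z ∈ openStrip)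
    (hd : DifferentiableAt ℝ u z) : |dx u z| ^ p ≤ p * A ^ (p - 1) * dt u z := by
  have hq := hpq.symm.pos
  have hp := hpq.pos
  have hv : ∀ v, -(v * dx u z) - A * |v| ^ q / q ≤ dt u z :=
    fun v => hu.neg_mul_dx_sub_le hpq haL ha haA hz hd v
  obtain ⟨σ, hσ, hσξ⟩ : ∃ σ : ℝ, |σ| = 1 ∧ σ * dx u z = |dx u z| := by
    rcases le_total 0 (dx u z) with h | h
    · exact ⟨1, by simp, by simp [abs_of_nonneg h]⟩
    · exact ⟨-1, by simp, by simp [abs_of_nonpos h]⟩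
  set b : ℝ := |dx u z| / A with hb
  have hb0 : 0 ≤ b := by positivity
  have hξ : |dx u z| = A * b := by rw [hb]; field_simp
  -- The velocity that maximises `-(v ξ) - A |v|^q / q` for `ξ = dx u z`.
  have h := hv (-σ * b ^ (p - 1))
  have e1 : |-σ * b ^ (p - 1)| ^ q = b ^ p := by
    rw [abs_mul, abs_neg, hσ, one_mul, abs_of_nonneg (by positivity), ← Real.rpow_mul hb0,
      hpq.sub_one_mul_conj]
  have e2 : -(-σ * b ^ (p - 1) * dx u z) = A * b ^ p := by
    have : b ^ p = b ^ (p - 1) * b := by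
      rw [← Real.rpow_add_one' hb0 (by linarith)]; ring_nf
    rw [this]
    linear_combination b ^ (p - 1) * hσξ + b ^ (p - 1) * hξ
  rw [e1, e2] at h
  have e3 : |dx u z| ^ p = A ^ (p - 1) * (A * b ^ p) := by
    rw [hξ, Real.mul_rpow hA.le hb0, ← mul_assoc, ← Real.rpow_add_one hA.ne']
    ring_nf
  have e4 : A * b ^ p - A * b ^ p / q = A * b ^ p / p := by
    have h1 := hpq.inv_add_inv_eq_one
    linear_combination -(A * b ^ p) * h1
  rw [e4, div_le_iff₀ hp] at h
  rw [e3, mul_comm p, mul_assoc, mul_comm p]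
  exact mul_le_mul_of_nonneg_left h (by positivity)

end Bounds

/-! ### The asymptotic lower bound at `x = 0`. -/

/-- One-sided Dini argument: a strict lower bound reached at one index persists nearby by continuity
and later by monotonicity. The limit need not be continuous, as with `a` and `g`. -/
theorem exists_forall_lt_of_monotone {E : Type*} [TopologicalSpace E] {S : Set E}
    (hS : IsCompact S) {f : ℕ → E → ℝ} {F : E → ℝ} {l : ℝ}
    (hc : ∀ n, 1 ≤ n → ContinuousOn (f n) S)
    (hmono : ∀ n, 1 ≤ n → ∀ z ∈ S, f n z ≤ f (n + 1) z)
    (hlim : ∀ z ∈ S, Tendsto (fun n => f n z) atTop (𝓝 (F z))) (hl : ∀ z ∈ S, l < F z) :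
    ∃ N, 1 ≤ N ∧ ∀ n, N ≤ n → ∀ z ∈ S, l < f n z := by
  suffices h : ∃ N, 1 ≤ N ∧ ∀ n, N ≤ n → ∀ z ∈ S, z ∈ S → l < f n z by
    obtain ⟨N, hN, h⟩ := h
    exact ⟨N, hN, fun n hn z hz => h n hn z hz hz⟩
  refine hS.induction_on (p := fun T => ∃ N, 1 ≤ N ∧ ∀ n, N ≤ n → ∀ z ∈ T, z ∈ S → l < f n z)
    ⟨1, le_rfl, by simp⟩ ?_ ?_ ?_
  · rintro s t hst ⟨N, hN, h⟩
    exact ⟨N, hN, fun n hn z hz => h n hn z (hst hz)⟩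
  · rintro s t ⟨N, hN, h⟩ ⟨N', hN', h'⟩
    refine ⟨max N N', hN.trans (le_max_left _ _), fun n hn z hz => ?_⟩
    rcases hz with hz | hz
    · exact h n ((le_max_left _ _).trans hn) z hz
    · exact h' n ((le_max_right _ _).trans hn) z hz
  · intro z hz
    obtain ⟨N, hN, hN1⟩ := (((hlim z hz).eventually_const_lt (hl z hz)).and
      (eventually_ge_atTop 1)).exists
    refine ⟨_, (hc N hN1 z hz).eventually_const_lt hN, N, hN1, fun n hn w hw hwS => ?_⟩
    induction n, hn using Nat.le_induction with
    | base => exact hw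
    | succ n hn ih => exact ih.trans_le (hmono n (hN1.trans hn) w hwS)

/-- The barrier with exponent `m = q α / γ` is a subsolution for the coefficient `A` wherever it
lies above the fundamental solution issued from the origin. -/
theorem curve_barrier_subsolution {p q γ α A k c b : ℝ} (hpq : p.HolderConjugate q) (hγ : 0 < γ)
    (hα : 0 < α) (hA : 0 < A) (hk : 0 < k) (hc : c = A * (γ ^ q / (q * α))) {z : ℝ × ℝ}
    (ht : 0 < z.1) (hx : z.2 ≠ 0) {A' : ℝ} (hA' : A ≤ A')
    (hle : k * (|z.2| ^ (q * α / γ) * z.1 ^ (-((q - 1) * α))) ≤ c * (|z.2| ^ q * z.1 ^ (-(q - 1)))) :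
    |dx (barrier k (q * α / γ) ((q - 1) * α) b 0 0) z| ^ p / (p * A' ^ (p - 1)) ≤
      dt (barrier k (q * α / γ) ((q - 1) * α) b 0 0) z := by
  have hq := hpq.symm.pos
  have hq1 : 0 < q - 1 := sub_pos.2 hpq.symm.lt
  have hp := hpq.pos
  have hp1 : 0 < p - 1 := sub_pos.2 hpq.lt
  have hc0 : 0 < c := by rw [hc]; positivity
  set m : ℝ := q * α / γ with hm
  set e : ℝ := (q - 1) * α with he
  have hm0 : 0 < m := by positivity
  have hy : 0 < |z.2| := abs_pos.2 hx
  have e1 : (q - 1) * p = q := hpq.symm.sub_one_mul_conj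
  have e2 : (p - 1) * q = p := hpq.sub_one_mul_conj
  rw [abs_dx_barrier hk.le hm0.le ht (Or.inr (by simpa using hx)), dt_barrier ht]
  simp only [sub_zero]
  generalize |z.2| = y at *
  generalize z.1 = t at *
  -- This identity makes `k = c` critical: with `A' = A` the barrier then satisfies the equation
  -- exactly on `x = t^γ`.
  have hid : (c * m) ^ p = e * c * p * A ^ (p - 1) := by
    have h1 : c * m = A * γ ^ (q - 1) := by
      rw [hc, hm, Real.rpow_sub_one hγ.ne']; field_simp
    have h2 : A ^ p = A ^ (p - 1) * A := by
      rw [← Real.rpow_add_one hA.ne']; ring_nf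
    rw [h1, Real.mul_rpow hA.le (by positivity), ← Real.rpow_mul hγ.le, e1, h2, hc, he]
    field_simp
    linear_combination (-1 : ℝ) * e1
  set Z : ℝ := k / c * (y ^ m * t ^ (-e)) with hZ
  have hZ0 : 0 < Z := by positivity
  have hZle : Z ≤ y ^ q * t ^ (-(q - 1)) := by
    rw [hZ, div_mul_eq_mul_div, div_le_iff₀ hc0]
    linarith
  have hZp : Z ^ p ≤ Z * (y ^ p * t⁻¹) := by
    have h1 : Z ^ p = Z * Z ^ (p - 1) := by
      rw [← Real.rpow_one_add' hZ0.le (by linarith)]; ring_nf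
    rw [h1]
    gcongr
    refine (Real.rpow_le_rpow hZ0.le hZle hp1.le).trans (le_of_eq ?_)
    rw [Real.mul_rpow (by positivity) (by positivity), ← Real.rpow_mul hy.le, ← Real.rpow_mul ht.le,
      mul_comm q, e2, show -(q - 1) * (p - 1) = -1 by linarith, Real.rpow_neg_one]
  have hkm : (k * m * y ^ (m - 1) * t ^ (-e)) = c * m * (Z / y) := by
    rw [hZ, Real.rpow_sub_one hy.ne']
    field_simp
  have hdt : k * e * y ^ m * t ^ (-e - 1) = e * c * (Z * t⁻¹) := by
    rw [hZ, Real.rpow_sub_one ht.ne']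
    field_simp
  have he0 : 0 < e := by positivity
  have hA'0 : 0 < A' := hA.trans_le hA'
  rw [hkm, hdt, Real.mul_rpow (by positivity) (by positivity), hid, Real.div_rpow hZ0.le hy.le,
    div_le_iff₀ (by positivity)]
  have h3 : Z ^ p / y ^ p ≤ Z * t⁻¹ := by
    rw [div_le_iff₀ (by positivity)]
    linarith
  calc e * c * p * A ^ (p - 1) * (Z ^ p / y ^ p) ≤ e * c * p * A' ^ (p - 1) * (Z * t⁻¹) := by
        gcongr
    _ = _ := by ring

theorem barrier_nonpos {k m e b : ℝ} (hk : 0 ≤ k) (hm : 0 ≤ m) (he : 0 ≤ e) (hb : b ≤ k)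
    {z : ℝ × ℝ} (ht : 0 < z.1) (ht1 : z.1 ≤ 1) (hx : 1 ≤ |z.2|) : barrier k m e b 0 0 z ≤ 0 := by
  have h1 : 1 ≤ |z.2| ^ m := Real.one_le_rpow hx hm
  have h2 : 1 ≤ z.1 ^ (-e) := Real.one_le_rpow_of_pos_of_le_one_of_nonpos ht ht1 (by linarith)
  have h3 := mul_le_mul_of_nonneg_left (one_le_mul_of_one_le_of_one_le h1 h2) hk
  simp only [barrier, sub_zero]
  linarith

theorem barrier_le {k m e b : ℝ} (hk : 0 ≤ k) {z : ℝ × ℝ} (ht : 0 < z.1) :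
    barrier k m e b 0 0 z ≤ b := by
  have : 0 ≤ k * (|z.2| ^ m * z.1 ^ (-e)) := by positivity
  simp only [barrier, sub_zero]
  linarith

/-- At `x = 0` the solutions are asymptotically at least the cost `c` of following the whole cheap
curve, locally uniformly in time. -/
theorem exists_forall_sub_le_at_zero {p q γ α M G c : ℝ} (hpq : p.HolderConjugate q) (hγ : 0 < γ)
    (hα : α = 1 - (1 - γ) * q) (hα0 : 0 < α) (hG : 0 < G)
    (hc : c = G⁻¹ * (γ ^ q / (q * α))) (hc1 : c < 1) (hM : c * q < M * G⁻¹)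
    {a : ℕ → ℝ × ℝ → ℝ} (ha : IsCostApproximation γ M G a)
    {g : ℕ → ℝ → ℝ} (hg : IsTerminalApproximation g) {u : ℕ → ℝ × ℝ → ℝ}
    (hu : ∀ n, 1 ≤ n → IsLipschitzViscositySolution p (a n) (g n) (u n))
    {t₀ η : ℝ} (ht₀ : t₀ ∈ Ioo (0 : ℝ) 1) (hη : 0 < η) :
    ∃ N, 1 ≤ N ∧ ∀ n, N ≤ n → ∀ t ∈ Ioc t₀ 1, c - η ≤ u n (t, 0) := by
  have hq := hpq.symm.pos
  have hq1 : 0 < q - 1 := sub_pos.2 hpq.symm.lt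
  have hc0 : 0 < c := by rw [hc]; positivity
  set d : ℝ := min η c / 2 with hd
  have hd0 : 0 < d := by have := lt_min hη hc0; positivity
  have hdη : 2 * d ≤ η := by rw [hd]; linarith [min_le_left η c]
  have hdc : 2 * d ≤ c := by rw [hd]; linarith [min_le_right η c]
  set τ : ℝ := t₀ ^ α with hτ
  have hτ0 : 0 < τ := Real.rpow_pos_of_pos ht₀.1 _
  have hτ1 : τ < 1 := Real.rpow_lt_one ht₀.1.le ht₀.2 hα0
  have hdτ : 0 < d * τ := by positivity
  have hdτ1 : d * τ < d := by nlinarith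
  set m : ℝ := q * α / γ with hm
  set e : ℝ := (q - 1) * α with he
  have hm0 : 0 < m := by positivity
  have he0 : 0 < e := by positivity
  -- `W₁` is a subsolution only where `a_n ≥ c q`, so it must not be the larger one on the cheap
  -- curve; `W₂` tolerates `a_n = G⁻¹` but only where it dominates. Both powers equal `t^α` on `x =
  -- t^γ`, so there `W₁ - W₂ = d τ / 2 - d t^α < 0` for `t ≥ t₀`, while at `x = 0` the difference is
  -- `d τ / 2 > 0`.
  set W₁ : ℝ × ℝ → ℝ := barrier c q (q - 1) (c - (2 * d - d * τ / 2)) 0 0 with hW₁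
  set W₂ : ℝ × ℝ → ℝ := barrier (c - d) m e (c - d - d) 0 0 with hW₂
  have hWdiff : ∀ z, W₁ z - W₂ z = d * τ / 2 - c * (|z.2| ^ q * z.1 ^ (-(q - 1))) +
      (c - d) * (|z.2| ^ m * z.1 ^ (-e)) := by
    intro z
    simp only [hW₁, hW₂, barrier, sub_zero]
    ring
  have hW₁c : ContinuousOn W₁ (Ioi 0 ×ˢ univ) := continuousOn_barrier hq.le
  have hW₂c : ContinuousOn W₂ (Ioi 0 ×ˢ univ) := continuousOn_barrier hm0.le
  have hpos : ∀ z : ℝ × ℝ, 0 < z.1 → z.1 ≤ 1 → 0 < max (W₁ z) (W₂ z) → |z.2| ≤ 1 := by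
    intro z h0 h1 h2
    by_contra! h
    refine h2.not_ge (max_le ?_ ?_)
    · exact barrier_nonpos hc0.le hq.le hq1.le (by linarith) h0 h1 h.le
    · exact barrier_nonpos (by linarith) hm0.le he0.le (by linarith) h0 h1 h.le
  set S : Set (ℝ × ℝ) := {z ∈ Icc t₀ 1 ×ˢ Icc (-1) 1 | W₂ z ≤ W₁ z} with hS
  have hKsub : Icc t₀ 1 ×ˢ Icc (-1) 1 ⊆ Ioi (0 : ℝ) ×ˢ (univ : Set ℝ) :=
    prod_mono (fun t ht => ht₀.1.trans_le ht.1) (subset_univ _)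
  have hKcl : IsClosed (Icc t₀ 1 ×ˢ Icc (-1 : ℝ) 1) := isClosed_Icc.prod isClosed_Icc
  have hScpt : IsCompact S := (isCompact_Icc.prod isCompact_Icc).of_isClosed_subset
    (hKcl.isClosed_le (hW₂c.mono hKsub) (hW₁c.mono hKsub)) (fun z hz => hz.1)
  have hSstrip : S ⊆ closedStrip := fun z hz =>
    ⟨⟨ht₀.1.le.trans hz.1.1.1, hz.1.1.2⟩, mem_univ _⟩
  have hScurve : ∀ z ∈ S, z.2 ≠ z.1 ^ γ := by
    rintro ⟨t, x⟩ ⟨⟨⟨ht, ht1⟩, -⟩, hle⟩ hx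
    simp only at hx ht ht1
    have htp : 0 < t := ht₀.1.trans_le ht
    have h1 := hWdiff (t, x)
    simp only [hx] at h1 hle
    rw [abs_of_pos (by positivity), ← Real.rpow_mul htp.le, ← Real.rpow_mul htp.le,
      ← Real.rpow_add htp, ← Real.rpow_add htp, show γ * q + -(q - 1) = α by rw [hα]; ring,
      show γ * m + -e = α by rw [hm, he]; field_simp; ring] at h1
    have h2 : τ ≤ t ^ α := Real.rpow_le_rpow ht₀.1.le ht hα0.le
    have h3 := mul_le_mul_of_nonneg_left h2 hd0.le
    linarith
  -- On the compact set where `W₁` dominates, the curve is avoided and the limit coefficient is `M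
  -- G⁻¹ > c q`.
  obtain ⟨N₁, hN₁, haN⟩ := exists_forall_lt_of_monotone hScpt (l := c * q)
    (fun n hn => (ha.lipschitz n hn).choose_spec.continuousOn.mono hSstrip)
    (fun n hn z hz => ha.mono n hn z (hSstrip hz)) (fun z hz => ha.tendsto z (hSstrip hz))
    (fun z hz => by rw [costCoeff, if_neg (hScurve z hz)]; exact hM)
  -- At `t = x = 1` both barriers are negative, so `T` avoids the target and `g_n` eventually
  -- exceeds `c > max W₁ W₂` there.
  set T : Set ℝ := {x ∈ Icc (-1 : ℝ) 1 | 0 ≤ max (W₁ (1, x)) (W₂ (1, x))} with hT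
  have hline : ∀ W : ℝ × ℝ → ℝ, ContinuousOn W (Ioi 0 ×ˢ univ) → Continuous fun x => W (1, x) :=
    fun W hW => hW.comp_continuous (by fun_prop) fun x => ⟨mem_Ioi.2 one_pos, mem_univ _⟩
  have hTcpt : IsCompact T := isCompact_Icc.of_isClosed_subset
    (isClosed_Icc.isClosed_le continuousOn_const
      ((hline W₁ hW₁c).max (hline W₂ hW₂c)).continuousOn) (fun z hz => hz.1)
  have hT1 : ∀ x ∈ T, x ≠ 1 := by
    rintro x ⟨-, hx⟩ rfl
    refine hx.not_gt (max_lt ?_ ?_)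
    · simp only [hW₁, barrier, sub_zero, abs_one, Real.one_rpow]; linarith
    · simp only [hW₂, barrier, sub_zero, abs_one, Real.one_rpow]; linarith
  obtain ⟨N₂, hN₂, hgN⟩ := exists_forall_lt_of_monotone hTcpt (l := c)
    (fun n hn => (hg.lipschitz n hn).choose_spec.continuous.continuousOn)
    (fun n hn z _ => hg.mono n hn z) (fun z _ => hg.tendsto z)
    (fun z hz => by rw [terminalDatum, if_neg (hT1 z hz)]; exact hc1)
  refine ⟨max N₁ N₂, hN₁.trans (le_max_left _ _), fun n hn t ht => ?_⟩
  have hn₁ : N₁ ≤ n := (le_max_left _ _).trans hn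
  have hn₂ : N₂ ≤ n := (le_max_right _ _).trans hn
  have hn1 : 1 ≤ n := hN₁.trans hn₁
  have hun := hu n hn1
  have hA0 : 0 < G⁻¹ := inv_pos.2 hG
  have hu0 := hun.nonneg hpq hA0 (ha.lower n hn1) (hg.lower n hn1)
  have hbd : ∀ z : ℝ × ℝ, 0 < z.1 → max (W₁ z) (W₂ z) ≤ c := fun z hz =>
    max_le ((barrier_le hc0.le hz).trans (by linarith))
      ((barrier_le (by linarith) hz).trans (by linarith))
  have hzero : ∀ z : ℝ × ℝ, z.2 = 0 → 0 < W₁ z - W₂ z := by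
    intro z hz
    rw [hWdiff z, hz, abs_zero, Real.zero_rpow hq.ne', Real.zero_rpow hm0.ne']
    linarith
  have hmono : Ioc t₀ 1 ×ˢ (univ : Set ℝ) ⊆ Ioi 0 ×ˢ univ :=
    prod_mono (fun s hs => ht₀.1.trans hs.1) Subset.rfl
  have main := hun.supersolution.le_of_touching (W := fun z => max (W₁ z) (W₂ z)) (t₀ := t₀)
    (C := c) (R := 1) hun.lipschitz.choose_spec.continuousOn ht₀.1.le
    (ContinuousOn.sup (hW₁c.mono hmono) (hW₂c.mono hmono))
    (fun z hz => hbd z (ht₀.1.trans hz.1.1)) ?_ ?_ ?_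
    (z := (t, 0)) ⟨ht, mem_univ _⟩
  · refine le_trans ?_ ((le_max_left _ _).trans main)
    simp only [hW₁, barrier, sub_zero, abs_zero, Real.zero_rpow hq.ne', zero_mul, mul_zero]
    linarith
  · intro z hz hx
    refine le_trans (max_le ?_ ?_) (hu0 z ⟨⟨ht₀.1.le.trans hz.1.1.le, hz.1.2⟩, mem_univ _⟩)
    · exact barrier_nonpos hc0.le hq.le hq1.le (by linarith) (ht₀.1.trans hz.1.1) hz.1.2 hx
    · exact barrier_nonpos (by linarith) hm0.le he0.le (by linarith) (ht₀.1.trans hz.1.1) hz.1.2 hx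
  · intro x
    rw [hun.terminal]
    by_cases hxT : x ∈ T
    · exact (hbd (1, x) one_pos).trans (hgN n hn₂ x hxT).le
    · refine le_trans ?_ (hg.lower n hn1 x)
      by_contra! h
      exact hxT ⟨abs_le.1 (hpos (1, x) one_pos le_rfl h), h.le⟩
  · rintro z ⟨⟨hz0, hz1⟩, -⟩ hlt
    have hzp : 0 < z.1 := ht₀.1.trans hz0
    have hzs : z ∈ closedStrip := ⟨⟨hzp.le, hz1.le⟩, mem_univ _⟩
    have hx1 := hpos z hzp hz1.le ((hu0 z hzs).trans_lt hlt)
    have haz := ha.lower n hn1 z hzs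
    rcases le_total (W₂ z) (W₁ z) with h | h
    · refine ⟨W₁, contDiffAt_barrier hzp (Or.inl hpq.symm.lt), (max_eq_left h).symm,
        .of_forall fun w => le_max_left _ _, ?_⟩
      exact barrier_subsolution hpq hc0.le hzp (hA0.trans_le haz)
        (haN n hn₁ z ⟨⟨⟨hz0.le, hz1.le⟩, abs_le.1 hx1⟩, h⟩).le
    · have hx : z.2 ≠ 0 := fun hx => by linarith [hzero z hx]
      refine ⟨W₂, contDiffAt_barrier hzp (Or.inr (by simpa using hx)), (max_eq_right h).symm,
        .of_forall fun w => le_max_right _ _, ?_⟩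
      refine curve_barrier_subsolution hpq hγ hα0 hA0 (by linarith) hc hzp hx haz ?_
      linarith [hWdiff z]

/-! ### From oscillation to integral norms. -/

/-- The oscillation of a Lipschitz function on an interval is controlled by the `L^r` norm of its
derivative. -/
theorem enorm_sub_rpow_le_lintegral {f : ℝ → ℝ} {K : ℝ≥0} (hf : LipschitzWith K f) {l r : ℝ}
    (hl : 0 < l) (hr : 1 < r) :
    ‖f l - f 0‖ₑ ^ r ≤ (∫⁻ x in Ioc 0 l, ‖deriv f x‖ₑ ^ r) * ENNReal.ofReal l ^ (r - 1) := by
  have hac : AbsolutelyContinuousOnInterval f 0 l :=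
    (hf.lipschitzOnWith (s := uIcc 0 l)).absolutelyContinuousOnInterval
  have hr0 : 0 < r := one_pos.trans hr
  have hrr : (ENNReal.ofReal r).toReal = r := ENNReal.toReal_ofReal hr0.le
  have hne : ENNReal.ofReal r ≠ 0 := by simpa using hr0
  have h1 : ‖f l - f 0‖ₑ ≤ ∫⁻ x in Ioc 0 l, ‖deriv f x‖ₑ := by
    rw [← hac.integral_deriv_eq_sub, intervalIntegral.integral_of_le hl.le]
    exact enorm_integral_le_lintegral_enorm _
  have h2 := eLpNorm_le_eLpNorm_mul_rpow_measure_univ (p := 1) (q := ENNReal.ofReal r)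
    (μ := volume.restrict (Ioc 0 l)) (f := deriv f) (by simpa using hr.le)
    (measurable_deriv f).aestronglyMeasurable
  rw [eLpNorm_one_eq_lintegral_enorm, eLpNorm_eq_lintegral_rpow_enorm_toReal hne (by simp), hrr,
    Measure.restrict_apply_univ, Real.volume_Ioc, sub_zero] at h2
  have h3 := ENNReal.rpow_le_rpow (h1.trans h2) hr0.le
  rw [ENNReal.mul_rpow_of_nonneg _ _ hr0.le, ← ENNReal.rpow_mul, ← ENNReal.rpow_mul,
    one_div_mul_cancel hr0.ne', ENNReal.rpow_one] at h3
  convert h3 using 3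
  simp only [ENNReal.toReal_one]
  field_simp

/-- The unit square. -/
abbrev unitSquare : Set (ℝ × ℝ) := Ioo (0 : ℝ) 1 ×ˢ Ioo (0 : ℝ) 1

theorem measurableSet_unitSquare : MeasurableSet unitSquare :=
  measurableSet_Ioo.prod measurableSet_Ioo

theorem lintegral_inv_Ioo {t₀ B : ℝ} (h0 : 0 < t₀) (h1 : t₀ ≤ 1) (hB : 0 ≤ B) :
    ∫⁻ t in Ioo t₀ 1, ENNReal.ofReal (B * t⁻¹) = ENNReal.ofReal (B * -Real.log t₀) := by
  have hint : IntervalIntegrable (fun t : ℝ => B * t⁻¹) volume t₀ 1 := by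
    refine ContinuousOn.intervalIntegrable (continuousOn_const.mul
      (continuousOn_inv₀.mono fun t ht => ?_))
    rw [uIcc_of_le h1] at ht
    exact (h0.trans_le ht.1).ne'
  rw [restrict_Ioo_eq_restrict_Ioc, ← ofReal_integral_eq_lintegral_ofReal hint.1,
    ← intervalIntegral.integral_of_le h1, intervalIntegral.integral_const_mul,
    integral_inv_of_pos h0 one_pos, one_div, Real.log_inv]
  refine (ae_restrict_iff' measurableSet_Ioc).2 (.of_forall fun t ht => ?_)
  have : 0 < t := h0.trans ht.1
  simp only [Pi.zero_apply]
  positivity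

/-- If the oscillation of `u` between `x = 0` and `x = t^γ` is at least `b t^α`, with a
supercritical exponent, then `Du` has a logarithmically large `L^r` norm. -/
theorem le_lintegral_dx_rpow {u : ℝ × ℝ → ℝ} {K : ℝ≥0} (hu : LipschitzOnWith K u closedStrip)
    {α γ r b t₀ : ℝ} (hγ : 0 < γ) (hr : 1 < r) (hcrit : (α - γ) * r + γ ≤ -1) (hb : 0 < b)
    (ht₀ : t₀ ∈ Ioo (0 : ℝ) 1)
    (hosc : ∀ t ∈ Ioo t₀ 1, b * t ^ α ≤ u (t, 0) - u (t, t ^ γ)) :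
    ENNReal.ofReal (b ^ r * -Real.log t₀) ≤ ∫⁻ z in unitSquare, ‖dx u z‖ₑ ^ r := by
  have hr0 : 0 < r := one_pos.trans hr
  -- A globally Lipschitz extension makes the space derivative jointly measurable, as Tonelli's
  -- theorem requires.
  obtain ⟨v, hv, huv⟩ := hu.extend_real
  have hdx : ∀ z ∈ unitSquare, dx u z = dx v z := fun z hz => by
    simp only [dx]
    congr 1
    funext y
    exact huv ⟨⟨hz.1.1.le, hz.1.2.le⟩, mem_univ _⟩
  have hmeas : Measurable (dx v) :=
    measurable_deriv_with_param (f := fun t y => v (t, y)) hv.continuous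
  have hmeas' : Measurable fun z => ‖dx v z‖ₑ ^ r := hmeas.enorm.pow_const r
  rw [setLIntegral_congr_fun measurableSet_unitSquare fun z hz => by rw [hdx z hz],
    Measure.volume_eq_prod, ← Measure.prod_restrict, lintegral_prod _ hmeas'.aemeasurable,
    ← lintegral_inv_Ioo ht₀.1 ht₀.2.le (by positivity)]
  refine (setLIntegral_mono' measurableSet_Ioo fun t ht => ?_).trans
    (lintegral_mono_set (Ioo_subset_Ioo_left ht₀.1.le))
  have ht0 : 0 < t := ht₀.1.trans ht.1
  have hl0 : 0 < t ^ γ := Real.rpow_pos_of_pos ht0 _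
  have hl1 : t ^ γ < 1 := Real.rpow_lt_one ht0.le ht.2 hγ
  have hlip : LipschitzWith K fun y => v (t, y) := by
    have := hv.comp (LipschitzWith.prodMk_left t)
    rwa [mul_one] at this
  have h1 := enorm_sub_rpow_le_lintegral hlip hl0 hr
  have h2 : ENNReal.ofReal (b * t ^ α) ≤ ‖v (t, t ^ γ) - v (t, 0)‖ₑ := by
    have hts : ∀ x, (t, x) ∈ closedStrip := fun x => ⟨⟨ht0.le, ht.2.le⟩, mem_univ _⟩
    rw [← huv (hts _), ← huv (hts _), enorm_sub_rev, Real.enorm_eq_ofReal_abs]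
    exact ENNReal.ofReal_le_ofReal ((hosc t ht).trans (le_abs_self _))
  have h3 := (ENNReal.rpow_le_rpow h2 hr0.le).trans h1
  -- Since `t < 1`, this is the exponent condition `α r ≤ γ (r - 1) - 1`.
  have h4 : b ^ r * t⁻¹ * (t ^ γ) ^ (r - 1) ≤ (b * t ^ α) ^ r := by
    rw [Real.mul_rpow hb.le (by positivity), ← Real.rpow_mul ht0.le, ← Real.rpow_mul ht0.le,
      mul_assoc, ← Real.rpow_neg_one, ← Real.rpow_add ht0]
    gcongr ?_ * ?_
    exact Real.rpow_le_rpow_of_exponent_ge ht0 ht.2.le (by linarith)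
  have h5 := (ENNReal.ofReal_le_ofReal h4).trans
    ((ENNReal.ofReal_rpow_of_nonneg (by positivity) hr0.le).symm.trans_le h3)
  rw [ENNReal.ofReal_mul (by positivity),
    ← ENNReal.ofReal_rpow_of_nonneg hl0.le (by linarith)] at h5
  have h6 : ENNReal.ofReal (t ^ γ) ^ (r - 1) ≠ 0 :=
    (ENNReal.rpow_pos (by simpa using hl0) ENNReal.ofReal_ne_top).ne'
  have h7 : ENNReal.ofReal (t ^ γ) ^ (r - 1) ≠ ⊤ :=
    ENNReal.rpow_ne_top_of_nonneg (by linarith) ENNReal.ofReal_ne_top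
  refine ((ENNReal.mul_le_mul_iff_left h6 h7).1 h5).trans ?_
  exact lintegral_mono_set fun x hx => ⟨hx.1, hx.2.trans_lt hl1⟩

theorem BoundedInLp.exists_lintegral_le {r : ℝ} (hr : 0 < r) {f : ℕ → ℝ × ℝ → ℝ}
    (h : BoundedInLp r f) :
    ∃ C : ℝ≥0, ∀ n, 1 ≤ n → ∫⁻ z in unitSquare, ‖f n z‖ₑ ^ r ≤ C := by
  obtain ⟨C, hC⟩ := h
  refine ⟨C ^ r, fun n hn => ?_⟩
  have h1 := ENNReal.rpow_le_rpow (hC n hn) hr.le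
  rw [eLpNorm_eq_lintegral_rpow_enorm_toReal (by simpa using hr) (by simp),
    ENNReal.toReal_ofReal hr.le, ← ENNReal.rpow_mul, one_div_mul_cancel hr.ne',
    ENNReal.rpow_one] at h1
  rwa [ENNReal.coe_rpow_of_nonneg _ hr.le]

/-- The `L^(p s)` norm of `Du` is controlled by the `L^s` norm of `∂_t u`. -/
theorem IsLipschitzViscositySolution.lintegral_dx_rpow_le {p q A : ℝ} {a u : ℝ × ℝ → ℝ}
    {g : ℝ → ℝ} (hpq : p.HolderConjugate q) (haL : ∃ L : ℝ≥0, LipschitzOnWith L a closedStrip)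
    (ha : ∀ z ∈ closedStrip, 0 < a z) (hu : IsLipschitzViscositySolution p a g u) (hA : 0 < A)
    (haA : ∀ z ∈ openStrip, a z ≤ A) {s : ℝ} (hs : 0 < s) :
    ∫⁻ z in unitSquare, ‖dx u z‖ₑ ^ (p * s) ≤
      ENNReal.ofReal (p * A ^ (p - 1)) ^ s * ∫⁻ z in unitSquare, ‖dt u z‖ₑ ^ s := by
  obtain ⟨K, hK⟩ := hu.lipschitz
  have hp := hpq.pos
  rw [← lintegral_const_mul' _ _ (ENNReal.rpow_ne_top_of_nonneg hs.le ENNReal.ofReal_ne_top)]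
  refine lintegral_mono_ae ((ae_restrict_iff' measurableSet_unitSquare).2 ?_)
  -- Rademacher's theorem.
  filter_upwards [hK.ae_differentiableWithinAt_of_mem (μ := volume)] with z hz hzQ
  have hzo : z ∈ openStrip := ⟨hzQ.1, mem_univ _⟩
  have hnhds : closedStrip ∈ 𝓝 z :=
    mem_of_superset ((isOpen_Ioo.prod isOpen_univ).mem_nhds hzo)
      (prod_mono Ioo_subset_Icc_self Subset.rfl)
  have hd : DifferentiableAt ℝ u z := (hz (mem_of_mem_nhds hnhds)).differentiableAt hnhds
  have h1 := hu.abs_dx_rpow_le hpq haL ha hA haA hzo hd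
  rw [ENNReal.rpow_mul, ← ENNReal.mul_rpow_of_nonneg _ _ hs.le]
  refine ENNReal.rpow_le_rpow ?_ hs.le
  rw [Real.enorm_eq_ofReal_abs, Real.enorm_eq_ofReal_abs,
    ENNReal.ofReal_rpow_of_nonneg (abs_nonneg _) hp.le, ← ENNReal.ofReal_mul (by positivity)]
  refine ENNReal.ofReal_le_ofReal (h1.trans ?_)
  gcongr
  exact le_abs_self _

/-! ### Small critical exponents, and the conclusion. -/

/-- Let `q = 1 + s` and `γ = 2 s / (1 + s)`, twice the lower endpoint `1 - 1 / q`. Then `ε_* ≤ 3 s /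
(1 - s) ≤ 6 s` for `s ≤ 1 / 2`. -/
theorem exists_criticalEps_lt {η : ℝ} (hη : 0 < η) : ∃ p q γ : ℝ, 1 < p ∧ 1 / p + 1 / q = 1 ∧
    γ ∈ Ioo (1 - 1 / q) 1 ∧ criticalEps q γ < η := by
  obtain ⟨s, hs0, hs1, hs2⟩ : ∃ s : ℝ, 0 < s ∧ s ≤ 1 / 2 ∧ 6 * s < η :=
    ⟨min (1 / 2) (η / 12), lt_min (by norm_num) (by positivity), min_le_left _ _,
      by linarith [min_le_right (1 / 2 : ℝ) (η / 12)]⟩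
  have h1 : 0 < 1 + s := by positivity
  refine ⟨(1 + s) / s, 1 + s, 2 * s / (1 + s), ?_, ?_, ⟨?_, ?_⟩, ?_⟩
  · rw [lt_div_iff₀ hs0]; linarith
  · field_simp; ring
  · rw [← sub_pos]
    have : 2 * s / (1 + s) - (1 - 1 / (1 + s)) = s / (1 + s) := by field_simp; ring
    rw [this]; positivity
  · rw [div_lt_one h1]; linarith
  · have e1 : (1 + s) * (1 - 2 * s / (1 + s)) = 1 - s := by field_simp; ring
    have e2 : 2 * s / (1 + s) * (1 + s + 1) + 1 - (1 + s) = 2 * s / (1 + s) + s := by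
      field_simp; ring
    have e3 : 2 * s / (1 + s) ≤ 2 * s := div_le_self (by positivity) (by linarith)
    rw [criticalEps, e1, e2, div_lt_iff₀ (by linarith)]
    nlinarith

end HJExample

end

open HJExample

theorem proposition6p1 (p q γ M G : ℝ) (hp : 1 < p) (hpq : 1 / p + 1 / q = 1)
    (hγ : γ ∈ Ioo (1 - 1 / q) 1)
    (hM : γ ^ q / (1 - (1 - γ) * q) < M)
    (hG : γ ^ q / (q * (1 - (1 - γ) * q)) < G)
    (a : ℕ → ℝ × ℝ → ℝ) (ha : HJExample.IsCostApproximation γ M G a)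
    (g : ℕ → ℝ → ℝ) (hg : HJExample.IsTerminalApproximation g)
    (u : ℕ → ℝ × ℝ → ℝ)
    (hu : ∀ n, 1 ≤ n → HJExample.IsLipschitzViscositySolution p (a n) (g n) (u n)) :
    (∀ n, 1 ≤ n → ∀ z ∈ HJExample.closedStrip, |u n z| ≤ 1) ∧
    (∀ ε : ℝ, HJExample.criticalEps q γ ≤ ε →
      ¬ HJExample.BoundedInLp (1 + ε) (fun n => HJExample.dt (u n)) ∧
      ¬ HJExample.BoundedInLp (p * (1 + ε)) (fun n => HJExample.dx (u n))) ∧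
    0 < HJExample.criticalEps q γ ∧
    (∀ η : ℝ, 0 < η → ∃ p' q' γ' : ℝ, 1 < p' ∧ 1 / p' + 1 / q' = 1 ∧
      γ' ∈ Ioo (1 - 1 / q') 1 ∧ HJExample.criticalEps q' γ' < η) := by
  have hH : p.HolderConjugate q := Real.holderConjugate_iff.2 ⟨hp, by simpa using hpq⟩
  have hq := hH.symm.pos
  have hq1 := hH.symm.lt
  have hp0 := hH.pos
  have hγ0 : 0 < γ := by
    have : 1 / q < 1 := (div_lt_one hq).2 hq1
    linarith [hγ.1]
  obtain ⟨α, hα⟩ : ∃ α, α = 1 - (1 - γ) * q := ⟨_, rfl⟩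
  have hα0 : 0 < α := by
    have h1 : (1 - γ) * q < 1 / q * q := mul_lt_mul_of_pos_right (by linarith [hγ.1]) hq
    rw [one_div_mul_cancel hq.ne'] at h1
    linarith
  rw [← hα] at hM hG
  have hG0 : 0 < G := lt_trans (by positivity) hG
  have hM0 : 0 < M := lt_trans (by positivity) hM
  have hA0 : 0 < G⁻¹ := inv_pos.2 hG0
  obtain ⟨c, hc⟩ : ∃ c, c = G⁻¹ * (γ ^ q / (q * α)) := ⟨_, rfl⟩
  have hc0 : 0 < c := by rw [hc]; positivity
  have hc1 : c < 1 := by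
    rw [hc, inv_mul_lt_iff₀ hG0, mul_one]
    exact hG
  have hcM : c * q < M * G⁻¹ := by
    have : c * q = γ ^ q / α * G⁻¹ := by rw [hc]; field_simp
    rw [this]
    gcongr
  have hapos : ∀ n, 1 ≤ n → ∀ z ∈ closedStrip, 0 < a n z := fun n hn z hz =>
    hA0.trans_le (ha.lower n hn z hz)
  have hden : 0 < q * (1 - γ) := mul_pos hq (by linarith [hγ.2])
  have hcrit0 : 0 < criticalEps q γ := by
    refine div_pos ?_ hden
    have : γ * (q + 1) + 1 - q = α + γ := by rw [hα]; ring
    rw [this]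
    positivity
  have hunbounded : ∀ ε, criticalEps q γ ≤ ε → ∀ C : ℝ≥0, ∃ n, 1 ≤ n ∧
      (C : ℝ≥0∞) < ∫⁻ z in unitSquare, ‖dx (u n) z‖ₑ ^ (p * (1 + ε)) := by
    intro ε hε C
    have hε0 : 0 < ε := hcrit0.trans_le hε
    have hr : 1 < p * (1 + ε) := by nlinarith
    have hexp : (α - γ) * (p * (1 + ε)) + γ ≤ -1 := by
      rw [criticalEps, div_le_iff₀ hden] at hε
      have e1 : (q - 1) * p = q := hH.symm.sub_one_mul_conj
      have e2 : (α - γ) * (p * (1 + ε)) = -(q * (1 - γ) * (1 + ε)) := by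
        rw [hα]; linear_combination (-(1 - γ) * (1 + ε)) * e1
      rw [e2]
      linarith
    have hbr : 0 < (c / 2) ^ (p * (1 + ε)) := by positivity
    -- With `t₀ = exp (-l)`, the logarithmic lower bound equals `C + 1`.
    set l : ℝ := (C + 1) / (c / 2) ^ (p * (1 + ε)) with hl
    have hl0 : 0 < l := by positivity
    have ht₀ : Real.exp (-l) ∈ Ioo (0 : ℝ) 1 :=
      ⟨Real.exp_pos _, by rw [Real.exp_lt_one_iff]; linarith⟩
    have hτ : 0 < Real.exp (-l) ^ α := Real.rpow_pos_of_pos ht₀.1 _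
    -- With `η = c t₀^α / 2`, the gap `c t^α - η` is at least `(c / 2) t^α` for all `t > t₀`.
    obtain ⟨N, hN, hlow⟩ := exists_forall_sub_le_at_zero hH hγ0 hα hα0 hG0 hc hc1 hcM ha hg hu ht₀
      (η := c * Real.exp (-l) ^ α / 2) (by positivity)
    refine ⟨N, hN, lt_of_lt_of_le ?_ (le_lintegral_dx_rpow (b := c / 2)
      (hu N hN).lipschitz.choose_spec hγ0 hr hexp (by positivity) ht₀ ?_)⟩
    · have : (c / 2) ^ (p * (1 + ε)) * -Real.log (Real.exp (-l)) = C + 1 := by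
        rw [Real.log_exp, neg_neg, hl]
        field_simp
      rw [this, ← ENNReal.ofReal_coe_nnreal]
      exact (ENNReal.ofReal_lt_ofReal_iff (by positivity)).2 (by linarith)
    · intro t ht
      have ht0 : 0 < t := ht₀.1.trans ht.1
      have h1 := hlow N le_rfl t ⟨ht.1, ht.2.le⟩
      have h2 := (hu N hN).le_on_curve hH (ha.lipschitz N hN) (hapos N hN) hα hα0 hγ0 (A := G⁻¹)
        (fun s hs => by
          have := ha.upper N hN (s, s ^ γ) ⟨⟨hs.1.le, hs.2.le⟩, mem_univ _⟩
          simpa [costCoeff] using this) ⟨ht0, ht.2⟩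
      have h3 : g N 1 ≤ 0 := by simpa [terminalDatum] using hg.upper N hN 1
      rw [← hc] at h2
      have h4 : Real.exp (-l) ^ α ≤ t ^ α := Real.rpow_le_rpow ht₀.1.le ht.1.le hα0.le
      have h5 := mul_le_mul_of_nonneg_left h4 hc0.le
      linarith
  refine ⟨fun n hn z hz => ?_, fun ε hε => ⟨fun hb => ?_, fun hb => ?_⟩, hcrit0,
    fun η hη => exists_criticalEps_lt hη⟩
  · rw [abs_of_nonneg ((hu n hn).nonneg hH hA0 (ha.lower n hn) (hg.lower n hn) z hz)]
    refine ((hu n hn).le_terminal hH (ha.lipschitz n hn) (hapos n hn) z hz).trans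
      ((hg.upper n hn _).trans ?_)
    rw [terminalDatum]
    split_ifs <;> norm_num
  · have hs : 0 < 1 + ε := by linarith
    obtain ⟨C, hC⟩ := hb.exists_lintegral_le hs
    set A : ℝ := max G⁻¹ (M * G⁻¹) with hA
    have hApos : 0 < A := hA0.trans_le (le_max_left _ _)
    have haA : ∀ n, 1 ≤ n → ∀ z ∈ openStrip, a n z ≤ A := fun n hn z hz => by
      refine (ha.upper n hn z ⟨⟨hz.1.1.le, hz.1.2.le⟩, mem_univ _⟩).trans ?_
      rw [costCoeff]
      split_ifs
      · exact le_max_left _ _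
      · exact le_max_right _ _
    have hD : ENNReal.ofReal (p * A ^ (p - 1)) ^ (1 + ε) * C ≠ ⊤ :=
      ENNReal.mul_ne_top (ENNReal.rpow_ne_top_of_nonneg hs.le ENNReal.ofReal_ne_top)
        ENNReal.coe_ne_top
    obtain ⟨n, hn, hlt⟩ := hunbounded ε hε (ENNReal.toNNReal _)
    rw [ENNReal.coe_toNNReal hD] at hlt
    refine hlt.not_ge (((hu n hn).lintegral_dx_rpow_le hH (ha.lipschitz n hn) (hapos n hn) hApos
      (haA n hn) hs).trans ?_)
    gcongr
    exact hC n hn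
  · obtain ⟨C, hC⟩ := hb.exists_lintegral_le (mul_pos hp0 (by linarith))
    obtain ⟨n, hn, hlt⟩ := hunbounded ε hε C
    exact hlt.not_ge (hC n hn)
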